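/- Let $n\ge 1$ and let $\mathbb H_n=\mathbb C^n\times\mathbb R$ be the Heisenberg group with the law $(z,s)(\tilde z,\tilde s)=(z+\tilde z,\,s+\tilde s+\tfrac12\operatorname{Im}\langle z,\tilde z\rangle)$, $\langle z,\tilde z\rangle=\sum_j\overline{z_j}\tilde z_j$, and with Lebesgue measure; $U(n)$ acts by $g\cdot(z,s)=(gz,s)$, and convolution is $(f*h)(x)=\int_{\mathbb H_n}f(xy^{-1})h(y)\,dy$. For $\lambda\in\mathbb R\setminus\{0\}$ and $k\in\mathbb N=\{0,1,2,\dots\}$ let $$\varphi_{\lambda,k}(z,s)=e^{i\lambda s}L_k^{n-1}\!\left(\tfrac{|\lambda|}{2}|z|^2\right)e^{-\frac{|\lambda|}{4}|z|^2},$$ where $L_k^{n-1}$ is the Laguerre polynomial of order $n-1$ and degree $k$ normalized by $L_k^{n-1}(0)=1$, and for $f\in L^1(\mathbb H_n)$ (complex valued) let $\widehat f(\lambda,k)=\int_{\mathbb H_n}f(x)\,\varphi_{\lambda,k}(x^{-1})\,dx$ be its spherical transform. Let $J:\mathbb H_n\to\mathbb R$ be integrable and $U(n)$-invariant with $\int_{\mathbb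 H_n}J=1$. Let $u_0\in L^1(\mathbb H_n)$ be $U(n)$-invariant with $\widehat{u_0}\in L^1(\Sigma)$, that is, $$\sum_{k\in\mathbb N}\int_{\mathbb R}|\widehat{u_0}(\lambda,k)|\,|\lambda|^n\,d\lambda<\infty .$$ Then there is exactly one $u\in C([0,\infty),L^1(\mathbb H_n))$ which is differentiable in $L^1(\mathbb H_n)$ at every $t>0$ and satisfies $$u_t=J*u-u\quad(t>0),\qquad u(0)=u_0 .$$ For every $t\ge 0$ the function $u(t)$ is $U(n)$-invariant, and its spherical transform is $$\widehat u(\lambda,k,t)=e^{(\widehat J(\lambda,k)-1)t}\,\widehat{u_0}(\lambda,k)\qquad(\lambda\in\mathbb R\setminus\{0\},\ k\in\mathbb N).$$ -/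

import Mathlib

open MeasureTheory
open scoped NNReal Matrix

noncomputable section

/-- The Heisenberg group `ℍₙ = ℂⁿ × ℝ`. -/
def Heisenberg (n : ℕ) : Type := (Fin n → ℂ) × ℝ

namespace Heisenberg

variable {n : ℕ}

/-- The point `(z, s)` of `ℍₙ`. -/
def mk (z : Fin n → ℂ) (s : ℝ) : Heisenberg n := (z, s)

/-- The component `z ∈ ℂⁿ` of `(z, s)`. -/
def z (x : Heisenberg n) : Fin n → ℂ := x.1

/-- The component `s ∈ ℝ` of `(z, s)`. -/
def s (x : Heisenberg n) : ℝ := x.2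

@[ext] theorem ext {x y : Heisenberg n} (hz : x.z = y.z) (hs : x.s = y.s) : x = y :=
  Prod.ext hz hs

/-- Lebesgue measure on `ℂⁿ × ℝ`, the Haar measure of `ℍₙ`. -/
instance : MeasureSpace (Heisenberg n) := inferInstanceAs (MeasureSpace ((Fin n → ℂ) × ℝ))

/-- The group law `(z, s)(w, r) = (z + w, s + r + ½ Im⟨z, w⟩)`. The Hermitian product
`⟨z, w⟩ = ∑ⱼ conj(zⱼ) wⱼ` is the one for which `Xⱼ = ∂/∂xⱼ - (yⱼ/2) ∂/∂s` and
`Yⱼ = ∂/∂yⱼ + (xⱼ/2) ∂/∂s` are left invariant. -/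
instance : Mul (Heisenberg n) :=
  ⟨fun x y => mk (x.z + y.z) (x.s + y.s + (1 / 2) * (star x.z ⬝ᵥ y.z).im)⟩

instance : One (Heisenberg n) := ⟨mk 0 0⟩

instance : Inv (Heisenberg n) := ⟨fun x => mk (-x.z) (-x.s)⟩

theorem mul_def (x y : Heisenberg n) :
    x * y = mk (x.z + y.z) (x.s + y.s + (1 / 2) * (star x.z ⬝ᵥ y.z).im) := rfl

theorem one_def : (1 : Heisenberg n) = mk 0 0 := rfl

theorem inv_def (x : Heisenberg n) : x⁻¹ = mk (-x.z) (-x.s) := rfl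

@[simp] theorem z_mk (z : Fin n → ℂ) (s : ℝ) : (mk z s).z = z := rfl

@[simp] theorem s_mk (z : Fin n → ℂ) (s : ℝ) : (mk z s).s = s := rfl

theorem im_star_dotProduct_self (z : Fin n → ℂ) : (star z ⬝ᵥ z).im = 0 := by
  simp only [dotProduct, Complex.im_sum, Pi.star_apply]
  refine Finset.sum_eq_zero fun i _ => ?_
  simp [Complex.mul_im]
  ring

instance : Group (Heisenberg n) :=
  Group.ofLeftAxioms
    (by
      intro x y w
      ext1
      · simp [mul_def, add_assoc]
      · simp [mul_def, add_dotProduct, dotProduct_add]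
        ring)
    (by intro x; ext1 <;> simp [mul_def, one_def])
    (by
      intro x
      ext1
      · simp [mul_def, one_def, inv_def]
      · simp [mul_def, one_def, inv_def, im_star_dotProduct_self])

/-- The action `g · (z, s) = (g z, s)` of `U(n)` on `ℍₙ`. -/
def rotate (g : Matrix.unitaryGroup (Fin n) ℂ) (x : Heisenberg n) : Heisenberg n :=
  mk ((g : Matrix (Fin n) (Fin n) ℂ) *ᵥ x.z) x.s

/-- Invariance under the action of `U(n)`, for functions taken modulo null sets. -/
def UnitaryInvariant {E : Type*} (f : Heisenberg n → E) : Prop :=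
  ∀ g : Matrix.unitaryGroup (Fin n) ℂ, ∀ᵐ x : Heisenberg n, f (rotate g x) = f x

/-- The convolution `(J ∗ u)(x) = ∫ J(x y⁻¹) u(y) dy` on `ℍₙ`. -/
def conv (J : Heisenberg n → ℝ) (u : Heisenberg n → ℂ) (x : Heisenberg n) : ℂ :=
  ∫ y : Heisenberg n, (J (x * y⁻¹) : ℂ) * u y

/-- The generalized Laguerre polynomial of order `a` and degree `k`, in the classical
normalization `∑ⱼ (-1)ʲ C(k + a, k - j) xʲ / j!`. -/
def laguerre (a k : ℕ) (x : ℝ) : ℝ :=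
  ∑ j ∈ Finset.range (k + 1), (-1) ^ j * ((k + a).choose (k - j) : ℝ) / (j.factorial : ℝ) * x ^ j

/-- The Laguerre polynomial rescaled so that its value at `0` is `1`. -/
def laguerreNormalized (a k : ℕ) (x : ℝ) : ℝ := laguerre a k x / laguerre a k 0

/-- `|z|²` for the Hermitian norm on `ℂⁿ`. -/
def normSqZ (x : Heisenberg n) : ℝ := ∑ j, ‖x.z j‖ ^ 2

/-- The spherical function
`φ_{l,k}(z, s) = exp(i l s) L_k^{n-1}(|l| |z|² / 2) exp(-|l| |z|² / 4)` (for `n ≥ 1`, `l ≠ 0`). -/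
def sphericalFunction (l : ℝ) (k : ℕ) (x : Heisenberg n) : ℂ :=
  Complex.exp (Complex.I * l * x.s) *
    (laguerreNormalized (n - 1) k (|l| / 2 * x.normSqZ) : ℂ) *
    (Real.exp (-(|l| / 4) * x.normSqZ) : ℂ)

/-- The spherical transform `f̂(l, k) = ∫ f(x) φ_{l,k}(x⁻¹) dx`. -/
def sphericalTransform (f : Heisenberg n → ℂ) (l : ℝ) (k : ℕ) : ℂ :=
  ∫ x : Heisenberg n, f x * sphericalFunction l k x⁻¹

/-- The measure on the spectrum `Σ`, in the coordinates `(l, k)`: it has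
`∫ g = ∑ₖ ∫ g(l, k) |l|ⁿ dl`. The remaining points of `Σ` (a half line) and `l = 0` are null. -/
def spectrumMeasure (n : ℕ) : Measure (ℝ × ℕ) :=
  ((volume : Measure ℝ).withDensity fun l => ENNReal.ofReal (|l| ^ n)).prod Measure.count

/-- `J` is a real integrable `U(n)`-invariant function on `ℍₙ` with integral `1`. -/
structure IsKernel (J : Heisenberg n → ℝ) : Prop where
  integrable : Integrable J
  invariant : UnitaryInvariant J
  integral_eq_one : ∫ x, J x = 1

/-- `u ∈ C([0,∞), L¹(ℍₙ))` solves `u_t = J ∗ u - u`, `u(0) = u₀`; the time derivative is that of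
an `L¹`-valued function, and the equation is required for `t > 0`. -/
structure IsCauchySolution (J : Heisenberg n → ℝ) (u₀ : Heisenberg n →₁[volume] ℂ)
    (u : C(ℝ≥0, Heisenberg n →₁[volume] ℂ)) : Prop where
  initial : u 0 = u₀
  equation : ∀ t : ℝ≥0, 0 < t → ∃ w : Heisenberg n →₁[volume] ℂ,
    HasDerivAt (fun r : ℝ => u r.toNNReal) w (t : ℝ) ∧
      ∀ᵐ x : Heisenberg n, w x = conv J (u t) x - u t x

end Heisenberg

end

noncomputable section

namespace Heisenberg

variable {n : ℕ}

/-! Convolution by `J` has norm at most `‖J‖₁` on `L¹`, so `A = (J ∗ ·) - 1` is bounded and the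
equation is a linear ODE in a Banach space. The curve `exp(tA) u₀` solves it. For any solution `v`,
the curve `exp(-tA) v(t)` has zero derivative for `t > 0`; continuity at `0` then forces `v(t) =
exp(tA) u₀`. Since `J` is invariant, `A` preserves the closed subspace of `U(n)`-invariant elements,
hence so does `exp(tA)`. On that subspace, integration against `φ_{l,k}(x⁻¹)` is an eigenfunctional
of `A` with eigenvalue `Ĵ(l,k) - 1`, and the exponential series yields the formula for the
transform.

The substance is the multiplicativity behind this eigenvalue, `sphericalTransform_conv`. Against
invariant functions, `φ_{l,k}(x⁻¹)` may be replaced by a coefficient `χ` (`fockCoefficient`) in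
which the order `n - 1` Laguerre polynomial in `|z|²` becomes the order `0` one in a single `|zᵢ|²`.
Indeed the moments of `|z|^{2j}` and `|zᵢ|^{2j}` against an invariant weight differ by the factor
`C(n+j-1, j)` (`integral_mul_hermNormSq_pow`), which is the ratio of the order `0` Laguerre
coefficients to the normalized order `n - 1` ones (`choose_ratio`).

For invariant `u` one has `∫ u(y) χ(xy) dy = χ(x) ∫ u χ`. Averaging over a common phase of the
coordinates other than `i` removes their cross terms with `x`, by the mean value property. Averaging
over the phase of `yᵢ` leaves the product formula `circleAverage_laguerre_mul_exp`, which rests on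
Vandermonde's identity. -/

/-! ### Invariant measure on the Heisenberg group and the unitary action -/

theorem measurable_z : Measurable (z : Heisenberg n → Fin n → ℂ) :=
  (measurable_fst : Measurable (Prod.fst : (Fin n → ℂ) × ℝ → _))

theorem measurable_s : Measurable (s : Heisenberg n → ℝ) :=
  (measurable_snd : Measurable (Prod.snd : (Fin n → ℂ) × ℝ → _))

theorem measurable_mk {α : Type*} [MeasurableSpace α] {f : α → Fin n → ℂ} {g : α → ℝ}
    (hf : Measurable f) (hg : Measurable g) : Measurable fun a => mk (f a) (g a) :=
  (hf.prodMk hg : Measurable fun a => ((f a, g a) : (Fin n → ℂ) × ℝ))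

theorem measurable_z_apply (i : Fin n) : Measurable fun x : Heisenberg n => x.z i :=
  (measurable_pi_apply i).comp measurable_z

instance : SigmaFinite (volume : Measure (Heisenberg n)) :=
  inferInstanceAs (SigmaFinite (volume : Measure ((Fin n → ℂ) × ℝ)))

instance : MeasurableMul₂ (Heisenberg n) := by
  constructor
  have h1 : Measurable fun p : Heisenberg n × Heisenberg n => p.1.z :=
    measurable_z.comp measurable_fst
  have h2 : Measurable fun p : Heisenberg n × Heisenberg n => p.2.z :=
    measurable_z.comp measurable_snd
  have h3 : Measurable fun p : Heisenberg n × Heisenberg n => p.1.s :=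
    measurable_s.comp measurable_fst
  have h4 : Measurable fun p : Heisenberg n × Heisenberg n => p.2.s :=
    measurable_s.comp measurable_snd
  refine measurable_mk (h1.add h2) ((h3.add h4).add (measurable_const.mul ?_))
  refine Complex.measurable_im.comp ?_
  simp only [dotProduct, Pi.star_apply]
  refine Finset.measurable_sum _ fun i _ => ?_
  have h5 : Measurable fun p : Heisenberg n × Heisenberg n => p.1.z i :=
    (measurable_pi_apply i).comp h1
  exact (continuous_star.measurable.comp h5).mul ((measurable_pi_apply i).comp h2)

instance : MeasurableInv (Heisenberg n) :=
  ⟨measurable_mk measurable_z.neg measurable_s.neg⟩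

/-- Right translation is a skew product: a translation in `z`, and over each fixed `z` a translation
in `s`. -/
theorem measurePreserving_mul_right (y : Heisenberg n) :
    MeasurePreserving (fun x : Heisenberg n => x * y) volume volume := by
  have h : MeasurePreserving
      (fun p : (Fin n → ℂ) × ℝ => (p.1 + y.z, p.2 + y.s + (1 / 2) * (star p.1 ⬝ᵥ y.z).im))
      (volume.prod volume) (volume.prod volume) := by
    refine MeasurePreserving.skew_product (measurePreserving_add_right volume y.z)
      (g := fun a r => r + y.s + (1 / 2) * (star a ⬝ᵥ y.z).im) ?_ ?_
    · simp only [dotProduct, Pi.star_apply]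
      fun_prop
    · refine Filter.Eventually.of_forall fun a => ?_
      simp only [add_assoc]
      exact (measurePreserving_add_right volume _).map_eq
  exact h

instance : (volume : Measure (Heisenberg n)).IsMulRightInvariant :=
  ⟨fun y => (measurePreserving_mul_right y).map_eq⟩

theorem measurable_rotate (g : Matrix.unitaryGroup (Fin n) ℂ) :
    Measurable (rotate g : Heisenberg n → Heisenberg n) := by
  have hc : Continuous fun v : Fin n → ℂ => (g : Matrix (Fin n) (Fin n) ℂ) *ᵥ v :=
    Continuous.matrix_mulVec continuous_const continuous_id
  exact measurable_mk (hc.measurable.comp measurable_z) measurable_s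

/-- The real determinant of a complex linear map is the squared modulus of its complex determinant,
here `1`. -/
theorem measurePreserving_unitary_mulVec (g : Matrix.unitaryGroup (Fin n) ℂ) :
    MeasurePreserving (fun v : Fin n → ℂ => (g : Matrix (Fin n) (Fin n) ℂ) *ᵥ v)
      volume volume := by
  have hc : Continuous fun v : Fin n → ℂ => (g : Matrix (Fin n) (Fin n) ℂ) *ᵥ v :=
    Continuous.matrix_mulVec continuous_const continuous_id
  refine ⟨hc.measurable, ?_⟩
  have hdet : LinearMap.det ((Matrix.toLin' (g : Matrix (Fin n) (Fin n) ℂ)).restrictScalars ℝ)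
      = 1 := by
    rw [LinearMap.det_restrictScalars, LinearMap.det_toLin', Algebra.norm_complex_apply]
    have := Matrix.det_of_mem_unitary g.2
    rw [Complex.normSq_eq_norm_sq, CStarRing.norm_of_mem_unitary this, one_pow]
  have h := Measure.map_linearMap_addHaar_eq_smul_addHaar
    (volume : Measure (Fin n → ℂ)) (f := (Matrix.toLin'
      (g : Matrix (Fin n) (Fin n) ℂ)).restrictScalars ℝ) (by rw [hdet]; exact one_ne_zero)
  rw [hdet, inv_one, abs_one, ENNReal.ofReal_one, one_smul] at h
  exact h

theorem measurePreserving_rotate (g : Matrix.unitaryGroup (Fin n) ℂ) :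
    MeasurePreserving (rotate g : Heisenberg n → Heisenberg n) volume volume :=
  ((measurePreserving_unitary_mulVec g).prod (MeasurePreserving.id (volume : Measure ℝ)) :
    MeasurePreserving (Prod.map (fun v : Fin n → ℂ => (g : Matrix (Fin n) (Fin n) ℂ) *ᵥ v) id)
      (volume.prod volume) (volume.prod volume))

theorem star_unitary_mulVec_dotProduct (g : Matrix.unitaryGroup (Fin n) ℂ) (v w : Fin n → ℂ) :
    star ((g : Matrix (Fin n) (Fin n) ℂ) *ᵥ v) ⬝ᵥ ((g : Matrix (Fin n) (Fin n) ℂ) *ᵥ w)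
      = star v ⬝ᵥ w := by
  rw [Matrix.star_mulVec, Matrix.dotProduct_mulVec, Matrix.vecMul_vecMul,
    ← Matrix.star_eq_conjTranspose, Matrix.UnitaryGroup.star_mul_self, Matrix.vecMul_one]

theorem rotate_mul (g : Matrix.unitaryGroup (Fin n) ℂ) (x y : Heisenberg n) :
    rotate g (x * y) = rotate g x * rotate g y := by
  ext1
  · simp [rotate, mul_def, Matrix.mulVec_add]
  · simp only [rotate, mul_def, z_mk, s_mk, star_unitary_mulVec_dotProduct]

theorem rotate_inv (g : Matrix.unitaryGroup (Fin n) ℂ) (x : Heisenberg n) :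
    rotate g x⁻¹ = (rotate g x)⁻¹ := by
  ext1 <;> simp [rotate, inv_def, Matrix.mulVec_neg]

theorem rotate_inv_rotate (g : Matrix.unitaryGroup (Fin n) ℂ) (x : Heisenberg n) :
    rotate g⁻¹ (rotate g x) = x := by
  ext1
  · simp only [rotate, z_mk, Matrix.mulVec_mulVec]
    rw [← Submonoid.coe_mul, inv_mul_cancel]
    simp
  · rfl

/-- `rotate g` as a measurable equivalence. -/
def rotateEquiv (g : Matrix.unitaryGroup (Fin n) ℂ) : Heisenberg n ≃ᵐ Heisenberg n where
  toFun := rotate g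
  invFun := rotate g⁻¹
  left_inv := rotate_inv_rotate g
  right_inv x := by simpa using rotate_inv_rotate g⁻¹ x
  measurable_toFun := measurable_rotate g
  measurable_invFun := measurable_rotate g⁻¹

theorem integral_comp_rotate {E : Type*} [NormedAddCommGroup E] [NormedSpace ℝ E]
    (g : Matrix.unitaryGroup (Fin n) ℂ) (f : Heisenberg n → E) :
    ∫ x, f (rotate g x) = ∫ x, f x :=
  (measurePreserving_rotate g).integral_comp (rotateEquiv g).measurableEmbedding f

/-- In an integral against an invariant function, the other factor may be rotated. -/
theorem UnitaryInvariant.integral_mul_comp_rotate {f : Heisenberg n → ℂ}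
    (hf : UnitaryInvariant f) (g : Matrix.unitaryGroup (Fin n) ℂ) (F : Heisenberg n → ℂ) :
    ∫ x, f x * F (rotate g x) = ∫ x, f x * F x := by
  rw [← integral_comp_rotate g fun x => f x * F x]
  refine integral_congr_ae ?_
  filter_upwards [hf g] with x hx
  rw [hx]

/-! ### The convolution operator on `L¹` -/

theorem measurePreserving_mul_inv_prod :
    MeasurePreserving (fun p : Heisenberg n × Heisenberg n => (p.1 * p.2⁻¹, p.2))
      (volume.prod volume) (volume.prod volume) := by
  simpa only [div_eq_mul_inv] using measurePreserving_div_prod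
    (volume : Measure (Heisenberg n)) (volume : Measure (Heisenberg n))

theorem integrable_conv_kernel {J : Heisenberg n → ℝ} {u : Heisenberg n → ℂ}
    (hJ : Integrable J) (hu : Integrable u) :
    Integrable (fun p : Heisenberg n × Heisenberg n => (J (p.1 * p.2⁻¹) : ℂ) * u p.2)
      (volume.prod volume) :=
  measurePreserving_mul_inv_prod.integrable_comp_of_integrable (hJ.ofReal.mul_prod hu)

theorem integrable_conv {J : Heisenberg n → ℝ} {u : Heisenberg n → ℂ}
    (hJ : Integrable J) (hu : Integrable u) : Integrable (conv J u) :=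
  (integrable_conv_kernel hJ hu).integral_prod_left

/-- Integration of a convolution against a bounded function. -/
theorem integral_conv_mul {J : Heisenberg n → ℝ} {u χ : Heisenberg n → ℂ}
    (hJ : Integrable J) (hu : Integrable u) (hχ : Measurable χ) {C : ℝ} (hC : ∀ x, ‖χ x‖ ≤ C) :
    ∫ x, conv J u x * χ x = ∫ x, (J x : ℂ) * ∫ y, u y * χ (x * y) := by
  have hF : Integrable (fun p : Heisenberg n × Heisenberg n =>
      ((J p.1 : ℂ) * u p.2) * χ (p.1 * p.2)) (volume.prod volume) :=
    (hJ.ofReal.mul_prod hu).mul_bdd (hχ.comp measurable_mul).aestronglyMeasurable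
      (Filter.Eventually.of_forall fun p => hC _)
  have hG := measurePreserving_mul_inv_prod.integrable_comp_of_integrable hF
  have hme : MeasurableEmbedding
      (fun p : Heisenberg n × Heisenberg n => (p.1 * p.2⁻¹, p.2)) := by
    simp only [← div_eq_mul_inv]
    exact
      ((MeasurableEquiv.prodComm.trans (MeasurableEquiv.shearDivRight (Heisenberg n))).trans
        MeasurableEquiv.prodComm).measurableEmbedding
  -- Composed with the shear `(x, y) ↦ (x y⁻¹, y)`, the integrand `J(x) u(y) χ(xy)` becomes `J(x
  -- y⁻¹) u(y) χ(x)`. Fubini on both sides gives the two iterated integrals.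
  have h := measurePreserving_mul_inv_prod.integral_comp hme
    (fun p : Heisenberg n × Heisenberg n => ((J p.1 : ℂ) * u p.2) * χ (p.1 * p.2))
  rw [integral_prod _ hF] at h
  replace h := (integral_prod _ hG).symm.trans h
  simp only [Function.comp, inv_mul_cancel_right] at h
  simp only [conv, ← integral_mul_const, ← integral_const_mul]
  rw [h]
  simp only [mul_assoc]

theorem integral_norm_conv_le {J : Heisenberg n → ℝ} {u : Heisenberg n → ℂ}
    (hJ : Integrable J) (hu : Integrable u) :
    ∫ x, ‖conv J u x‖ ≤ (∫ x, ‖J x‖) * ∫ y, ‖u y‖ := by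
  have hK := (integrable_conv_kernel hJ hu).norm
  calc ∫ x, ‖conv J u x‖ ≤ ∫ x, ∫ y, ‖(J (x * y⁻¹) : ℂ) * u y‖ :=
        integral_mono (integrable_conv hJ hu).norm hK.integral_prod_left
          fun x => norm_integral_le_integral_norm _
    _ = ∫ y, ∫ x, ‖(J (x * y⁻¹) : ℂ) * u y‖ :=
        integral_integral_swap (f := fun x y => ‖(J (x * y⁻¹) : ℂ) * u y‖) hK
    _ = ∫ y, (∫ x, ‖J x‖) * ‖u y‖ := by
        refine integral_congr_ae (Filter.Eventually.of_forall fun y => ?_)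
        simp only [norm_mul, Complex.norm_real, integral_mul_const]
        rw [integral_mul_right_eq_self fun x => ‖J x‖]
    _ = _ := integral_const_mul _ _

/-- Convolution by an integrable kernel as a bounded operator on `L¹`. -/
def convL (J : Heisenberg n → ℝ) (hJ : Integrable J) :
    (Heisenberg n →₁[volume] ℂ) →L[ℂ] (Heisenberg n →₁[volume] ℂ) :=
  LinearMap.mkContinuous
    { toFun := fun u => (integrable_conv hJ (L1.integrable_coeFn u)).toL1 _
      map_add' := by
        intro u v
        rw [← Integrable.toL1_add, Integrable.toL1_eq_toL1_iff]
        -- The convolution integral converges only for almost every `x`, so additivity holds only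
        -- almost everywhere.
        have h1 := (integrable_conv_kernel hJ (L1.integrable_coeFn u)).prod_right_ae
        have h2 := (integrable_conv_kernel hJ (L1.integrable_coeFn v)).prod_right_ae
        filter_upwards [h1, h2] with x h1 h2
        simp only [conv, Pi.add_apply]
        rw [← integral_add h1 h2]
        refine integral_congr_ae ?_
        filter_upwards [Lp.coeFn_add u v] with y hy
        rw [hy, Pi.add_apply, mul_add]
      map_smul' := by
        intro c u
        rw [RingHom.id_apply, ← Integrable.toL1_smul', Integrable.toL1_eq_toL1_iff]
        refine Filter.Eventually.of_forall fun x => ?_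
        simp only [conv, Pi.smul_apply, smul_eq_mul]
        rw [← integral_const_mul]
        refine integral_congr_ae ?_
        filter_upwards [Lp.coeFn_smul c u] with y hy
        rw [hy, Pi.smul_apply, smul_eq_mul]
        ring }
    (∫ x, ‖J x‖) (by
      intro u
      simp only [LinearMap.coe_mk, AddHom.coe_mk, L1.norm_of_fun_eq_integral_norm]
      rw [L1.norm_eq_integral_norm]
      exact integral_norm_conv_le hJ (L1.integrable_coeFn u))

theorem coeFn_convL (J : Heisenberg n → ℝ) (hJ : Integrable J)
    (u : Heisenberg n →₁[volume] ℂ) : convL J hJ u =ᵐ[volume] conv J u :=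
  Integrable.coeFn_toL1 (integrable_conv hJ (L1.integrable_coeFn u))

/-! ### Invariant elements of `L¹` and bounded functionals -/

theorem UnitaryInvariant.congr {f h : Heisenberg n → ℂ} (hf : UnitaryInvariant f)
    (hfh : f =ᵐ[volume] h) : UnitaryInvariant h := by
  intro g
  filter_upwards [hf g, hfh, (measurePreserving_rotate g).quasiMeasurePreserving.ae_eq_comp hfh]
    with x h1 h2 h3
  simp only [Function.comp] at h3
  rw [← h2, ← h3, h1]

theorem UnitaryInvariant.conv {J : Heisenberg n → ℝ} {u : Heisenberg n → ℂ}
    (hJ : UnitaryInvariant J) (hu : UnitaryInvariant u) : UnitaryInvariant (conv J u) := by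
  intro g
  -- The exceptional null set of `J` is pulled back along the shear; its sections are null for
  -- almost every `x`, which is where the substitution `y ↦ g y` can be used.
  have h1 : ∀ᵐ p : Heisenberg n × Heisenberg n ∂(volume.prod volume),
      J (rotate g (p.1 * p.2⁻¹)) = J (p.1 * p.2⁻¹) :=
    measurePreserving_mul_inv_prod.quasiMeasurePreserving.ae
      (Measure.quasiMeasurePreserving_fst.ae (hJ g))
  filter_upwards [Measure.ae_ae_of_ae_prod h1] with x hx
  rw [Heisenberg.conv, Heisenberg.conv,
    ← integral_comp_rotate g fun y => (J (rotate g x * y⁻¹) : ℂ) * u y]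
  refine integral_congr_ae ?_
  filter_upwards [hx, hu g] with y hy huy
  rw [← rotate_inv, ← rotate_mul, hy, huy]

/-- The unitarily invariant elements of `L¹`. -/
def invariantSubmodule (n : ℕ) : Submodule ℂ (Heisenberg n →₁[volume] ℂ) where
  carrier := {u | UnitaryInvariant u}
  add_mem' := by
    intro u v hu hv
    refine UnitaryInvariant.congr (f := fun x => u x + v x) (fun g => ?_) (Lp.coeFn_add u v).symm
    filter_upwards [hu g, hv g] with x h1 h2
    rw [h1, h2]
  zero_mem' := UnitaryInvariant.congr (f := 0) (fun g => Filter.Eventually.of_forall fun _ => rfl)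
    (Lp.coeFn_zero _ _ _).symm
  smul_mem' := by
    intro c u hu
    refine UnitaryInvariant.congr (f := fun x => c • u x) (fun g => ?_) (Lp.coeFn_smul c u).symm
    filter_upwards [hu g] with x h1
    rw [h1]

theorem mem_invariantSubmodule {u : Heisenberg n →₁[volume] ℂ} :
    u ∈ invariantSubmodule n ↔ UnitaryInvariant u := Iff.rfl

/-- The subspace is the intersection of the fixed-point sets of the isometries `u ↦ u ∘ g`. -/
theorem isClosed_invariantSubmodule :
    IsClosed (invariantSubmodule n : Set (Heisenberg n →₁[volume] ℂ)) := by
  have h : (invariantSubmodule n : Set (Heisenberg n →₁[volume] ℂ)) =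
      ⋂ g : Matrix.unitaryGroup (Fin n) ℂ,
        {u | Lp.compMeasurePreserving (rotate g) (measurePreserving_rotate g) u = u} := by
    ext u
    simp only [SetLike.mem_coe, mem_invariantSubmodule, Set.mem_iInter, Set.mem_ofPred_eq]
    refine forall_congr' fun g => ?_
    rw [Lp.ext_iff]
    have hc := Lp.coeFn_compMeasurePreserving u (measurePreserving_rotate g)
    constructor
    · intro hu
      exact hc.trans hu
    · intro hu
      exact hc.symm.trans hu
  rw [h]
  exact isClosed_iInter fun g => isClosed_eq
    (Lp.isometry_compMeasurePreserving (measurePreserving_rotate g)).continuous continuous_id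

theorem convL_mem_invariantSubmodule {J : Heisenberg n → ℝ} (hJ : Integrable J)
    (hJi : UnitaryInvariant J) {u : Heisenberg n →₁[volume] ℂ} (hu : u ∈ invariantSubmodule n) :
    convL J hJ u ∈ invariantSubmodule n :=
  (UnitaryInvariant.conv hJi hu).congr (coeFn_convL J hJ u).symm

/-- Integration against a bounded measurable function as a functional on `L¹`. -/
def pairing (χ : Heisenberg n → ℂ) (hχ : Measurable χ) (C : ℝ) (hC : ∀ x, ‖χ x‖ ≤ C) :
    (Heisenberg n →₁[volume] ℂ) →L[ℂ] ℂ :=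
  have hint : ∀ u : Heisenberg n →₁[volume] ℂ, Integrable fun x => u x * χ x := fun u =>
    (L1.integrable_coeFn u).mul_bdd hχ.aestronglyMeasurable (Filter.Eventually.of_forall hC)
  LinearMap.mkContinuous
    { toFun := fun u => ∫ x, u x * χ x
      map_add' := by
        intro u v
        rw [← integral_add (hint u) (hint v)]
        refine integral_congr_ae ?_
        filter_upwards [Lp.coeFn_add u v] with x hx
        rw [hx, Pi.add_apply, add_mul]
      map_smul' := by
        intro c u
        rw [RingHom.id_apply, smul_eq_mul, ← integral_const_mul]
        refine integral_congr_ae ?_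
        filter_upwards [Lp.coeFn_smul c u] with x hx
        rw [hx, Pi.smul_apply, smul_eq_mul, mul_assoc] }
    C (by
      intro u
      rw [L1.norm_eq_integral_norm, ← integral_const_mul]
      refine (norm_integral_le_integral_norm _).trans ?_
      refine integral_mono (hint u).norm ((L1.integrable_coeFn u).norm.const_mul C) fun x => ?_
      simp only [norm_mul]
      rw [mul_comm]
      exact mul_le_mul_of_nonneg_right (hC x) (norm_nonneg _))

theorem pairing_apply {χ : Heisenberg n → ℂ} (hχ : Measurable χ) {C : ℝ} (hC : ∀ x, ‖χ x‖ ≤ C)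
    (u : Heisenberg n →₁[volume] ℂ) : pairing χ hχ C hC u = ∫ x, u x * χ x := rfl

/-! ### The order zero Laguerre polynomials -/

theorem laguerre_zero_order (k : ℕ) (x : ℝ) :
    laguerre 0 k x = ∑ j ∈ Finset.range (k + 1),
      (-1) ^ j * (k.choose j : ℝ) / (j.factorial : ℝ) * x ^ j := by
  refine Finset.sum_congr rfl fun j hj => ?_
  rw [add_zero, Nat.choose_symm (Nat.lt_succ_iff.1 (Finset.mem_range.1 hj))]

/-- Since `C(k,j) C(j,a) = C(k,a) C(k-a,j-a)`, this is Vandermonde's identity for `k = (k-a) + a`.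
The guard `j ≤ a + b` is needed because truncated subtraction would otherwise make the last binomial
equal to `1`. -/
theorem sum_choose_mul_choose_mul_choose (k a b : ℕ) :
    ∑ j ∈ Finset.range (k + 1),
      (if j ≤ a + b then k.choose j * j.choose a * a.choose (a + b - j) else 0)
      = k.choose a * k.choose b := by
  set F : ℕ → ℕ := fun j => k.choose j * j.choose a * a.choose (a + b - j) with hF
  have h1 : ∑ j ∈ Finset.range (k + 1), (if j ≤ a + b then F j else 0)
      = ∑ j ∈ Finset.range (a + b + 1), F j := by
    have e1 : ∑ j ∈ Finset.range (k + 1), (if j ≤ a + b then F j else 0)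
        = ∑ j ∈ Finset.range (k + 1 + (a + b + 1)), (if j ≤ a + b then F j else 0) := by
      refine Finset.sum_subset (Finset.range_subset_range.2 (by omega)) fun j _ hj => ?_
      have hj' : k < j := by have := mt Finset.mem_range.2 hj; omega
      simp [hF, Nat.choose_eq_zero_of_lt hj']
    have e2 : ∑ j ∈ Finset.range (a + b + 1), F j
        = ∑ j ∈ Finset.range (a + b + 1), (if j ≤ a + b then F j else 0) := by
      refine Finset.sum_congr rfl fun j hj => ?_
      rw [if_pos (Nat.lt_succ_iff.1 (Finset.mem_range.1 hj))]
    rw [e1, e2]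
    refine (Finset.sum_subset (Finset.range_subset_range.2 (by omega)) fun j _ hj => ?_).symm
    have := mt Finset.mem_range.2 hj
    rw [if_neg (by omega)]
  rw [h1, add_assoc, Finset.sum_range_add]
  have h2 : ∑ j ∈ Finset.range a, F j = 0 := by
    refine Finset.sum_eq_zero fun j hj => ?_
    simp [hF, Nat.choose_eq_zero_of_lt (Finset.mem_range.1 hj)]
  rw [h2, zero_add]
  by_cases hak : a ≤ k
  · have hv := Nat.add_choose_eq (k - a) a b
    rw [Nat.sub_add_cancel hak, Finset.Nat.sum_antidiagonal_eq_sum_range_succ_mk] at hv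
    rw [hv, Finset.mul_sum]
    refine Finset.sum_congr rfl fun i _ => ?_
    have : k.choose (a + i) * (a + i).choose a = k.choose a * (k - a).choose i := by
      by_cases h : a + i ≤ k
      · rw [Nat.choose_mul (Nat.le_add_right a i), Nat.add_sub_cancel_left]
      · rw [Nat.choose_eq_zero_of_lt (not_le.1 h),
          Nat.choose_eq_zero_of_lt (by omega : k - a < i)]
        simp
    simp only [hF]
    rw [this, Nat.add_sub_add_left, mul_assoc]
  · rw [Nat.choose_eq_zero_of_lt (by omega), zero_mul]
    refine Finset.sum_eq_zero fun i _ => ?_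
    simp only [hF]
    rw [Nat.choose_eq_zero_of_lt (by omega : k < a + i)]
    simp

theorem choose_mul_choose_div_factorial {a b j : ℕ} (hj : j ≤ a + b) :
    (j.choose a * j.choose b : ℂ) / (j.factorial * (a + b - j).factorial)
      = (j.choose a * a.choose (a + b - j) : ℂ) / (a.factorial * b.factorial) := by
  by_cases ha : a ≤ j
  swap
  · simp [Nat.choose_eq_zero_of_lt (not_le.1 ha)]
  by_cases hb : b ≤ j
  swap
  · rw [Nat.choose_eq_zero_of_lt (not_le.1 hb), Nat.choose_eq_zero_of_lt (by omega :
      a < a + b - j)]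
    simp
  have h1 : ((j.choose b * b.factorial * (j - b).factorial : ℕ) : ℂ) = j.factorial := by
    rw [Nat.choose_mul_factorial_mul_factorial hb]
  have h2 : ((a.choose (a + b - j) * (a + b - j).factorial * (j - b).factorial : ℕ) : ℂ)
      = a.factorial := by
    rw [← Nat.choose_mul_factorial_mul_factorial (by omega : a + b - j ≤ a),
      show a - (a + b - j) = j - b by omega]
  have hne : ∀ m : ℕ, (m.factorial : ℂ) ≠ 0 := fun m => by
    exact_mod_cast Nat.factorial_ne_zero m
  rw [div_eq_div_iff (mul_ne_zero (hne _) (hne _)) (mul_ne_zero (hne _) (hne _)), ← h1, ← h2]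
  push_cast
  ring

/-- The coefficient of `|z|^{2a} |w|^{2b}` in the Laguerre product formula. -/
theorem sum_choose_div_factorial (k a b : ℕ) :
    ∑ j ∈ Finset.range (k + 1), (if j ≤ a + b then
      (-1 : ℂ) ^ j * k.choose j / j.factorial *
        (j.choose a * j.choose b * ((-1) ^ (a + b - j) / (a + b - j).factorial)) else 0)
      = ((-1) ^ a * k.choose a / a.factorial) * ((-1) ^ b * k.choose b / b.factorial) := by
  have h := congrArg (fun m : ℕ => (-1 : ℂ) ^ (a + b) * (m : ℂ) / (a.factorial * b.factorial))
    (sum_choose_mul_choose_mul_choose k a b)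
  simp only [Nat.cast_sum, Finset.mul_sum, Finset.sum_div] at h
  refine (Finset.sum_congr rfl fun j _ => ?_).trans (h.trans ?_)
  · split_ifs with hj
    · have hs : (-1 : ℂ) ^ (a + b) = (-1) ^ j * (-1) ^ (a + b - j) := by
        rw [← pow_add, Nat.add_sub_cancel' hj]
      have := choose_mul_choose_div_factorial hj
      rw [hs]
      push_cast
      calc _ = (-1 : ℂ) ^ j * (-1) ^ (a + b - j) * k.choose j *
            ((j.choose a * j.choose b : ℂ) / (j.factorial * (a + b - j).factorial)) := by
            ring
        _ = _ := by rw [this]; ring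
    · simp
  · push_cast
    rw [pow_add]
    ring

/-! ### Averages over the circle -/

theorem circleAverage_exp_mul (κ : ℂ) :
    Real.circleAverage (fun a => Complex.exp (-(a * κ))) 0 1 = 1 := by
  have hd : Differentiable ℂ fun a : ℂ => Complex.exp (-(a * κ)) := by fun_prop
  rw [hd.diffContOnCl.circleAverage]
  simp

/-- On the unit circle `star a = a⁻¹`, so the average extracts the Taylor coefficient of `exp(-κ a)`
of index `q - p` by Cauchy's formula. When `p > q` the function is holomorphic and vanishes at the
centre. -/
theorem circleAverage_conj_pow_mul_pow_mul_exp (p q : ℕ) (κ : ℂ) :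
    Real.circleAverage (fun a => star a ^ q * a ^ p * Complex.exp (-(a * κ))) 0 1
      = if p ≤ q then (-κ) ^ (q - p) / (q - p).factorial else 0 := by
  have hsph : ∀ a ∈ Metric.sphere (0 : ℂ) |1|, star a * a = 1 := by
    intro a ha
    have ha' : ‖a‖ = 1 := by simpa using ha
    have := Complex.conj_mul' a
    rw [ha'] at this
    simpa using this
  split_ifs with h
  · obtain ⟨m, rfl⟩ := Nat.exists_eq_add_of_le h
    have hd : Differentiable ℂ fun a : ℂ => Complex.exp (-κ * a) := by fun_prop
    have hC := (hd.diffContOnCl (s := Metric.ball 0 1)).circleIntegral_one_div_sub_center_pow_smul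
      one_pos m
    rw [Real.circleAverage_congr_sphere (f₂ := fun a => (a ^ m)⁻¹ * Complex.exp (-κ * a)),
      Real.circleAverage_eq_circleIntegral one_ne_zero]
    · have e : ∀ a : ℂ, (a - 0)⁻¹ • ((a ^ m)⁻¹ * Complex.exp (-κ * a))
          = (1 / (a - 0) ^ (m + 1)) • Complex.exp (-κ * a) := by
        intro a
        simp only [smul_eq_mul, sub_zero, one_div, pow_succ, mul_inv]
        ring
      simp only [e]
      rw [hC, iteratedDeriv_cexp_const_mul]
      have hpi := Complex.two_pi_I_ne_zero
      simp only [Nat.add_sub_cancel_left, smul_eq_mul, mul_zero, Complex.exp_zero, mul_one]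
      field_simp
    · intro a ha
      have h1 := hsph a ha
      have ha0 : a ≠ 0 := by
        rintro rfl
        simp at h1
      have h2 : star a = a⁻¹ := eq_inv_of_mul_eq_one_left h1
      simp only [h2]
      rw [show -(a * κ) = -κ * a by ring, inv_pow, pow_add]
      field_simp
  · obtain ⟨m, rfl⟩ := Nat.exists_eq_add_of_lt (not_le.1 h)
    rw [Real.circleAverage_congr_sphere (f₂ := fun a => a ^ (m + 1) * Complex.exp (-(a * κ)))]
    · have hd : Differentiable ℂ fun a : ℂ => a ^ (m + 1) * Complex.exp (-(a * κ)) := by fun_prop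
      rw [hd.diffContOnCl.circleAverage]
      simp
    · intro a ha
      have h1 := hsph a ha
      simp only
      rw [show star a ^ q * a ^ (q + m + 1) = (star a * a) ^ q * a ^ (m + 1) by ring, h1, one_pow,
        one_mul]

theorem circleAverage_norm_pow_mul_exp (j : ℕ) (z w : ℂ) :
    Real.circleAverage (fun a => (‖z + a * w‖ ^ 2 : ℂ) ^ j * Complex.exp (-(a * (star z * w)))) 0 1
      = ∑ b ∈ Finset.range (j + 1), ∑ a ∈ Finset.range (j + 1),
          if j ≤ a + b then (j.choose a * j.choose b * ((-1) ^ (a + b - j) / (a + b - j).factorial))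
            * ((‖z‖ ^ 2 : ℂ) ^ a * (‖w‖ ^ 2 : ℂ) ^ b) else 0 := by
  have hexp : ∀ a : ℂ, (‖z + a * w‖ ^ 2 : ℂ) ^ j * Complex.exp (-(a * (star z * w)))
      = ∑ q ∈ Finset.range (j + 1), ∑ p ∈ Finset.range (j + 1),
        ((star w ^ q * star z ^ (j - q) * j.choose q) * (w ^ p * z ^ (j - p) * j.choose p)) •
          (star a ^ q * a ^ p * Complex.exp (-(a * (star z * w)))) := by
    intro a
    have h1 : (‖z + a * w‖ ^ 2 : ℂ) = (star a * star w + star z) * (a * w + z) := by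
      rw [← Complex.conj_mul']
      simp only [← starRingEnd_apply, map_add, map_mul]
      ring
    rw [h1, mul_pow, add_pow, add_pow, Finset.sum_mul_sum, Finset.sum_mul]
    refine Finset.sum_congr rfl fun q _ => ?_
    rw [Finset.sum_mul]
    refine Finset.sum_congr rfl fun p _ => ?_
    simp only [mul_pow, smul_eq_mul]
    ring
  simp only [hexp]
  have hci : ∀ (c : ℂ) (p q : ℕ), CircleIntegrable
      (fun a : ℂ => c • (star a ^ q * a ^ p * Complex.exp (-(a * (star z * w))))) 0 1 := by
    intro c p q
    exact ContinuousOn.circleIntegrable' (Continuous.continuousOn (by fun_prop))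
  rw [Real.circleAverage_fun_sum fun q _ => CircleIntegrable.fun_sum _ fun p _ => hci _ p q]
  refine Finset.sum_congr rfl fun q hq => ?_
  -- After the reflection `p = j - a`, the new index `a` is the exponent of `|z|²`, and `p ≤ q`
  -- reads `j ≤ a + q`.
  rw [Real.circleAverage_fun_sum fun p _ => hci _ p q, ← Finset.sum_range_reflect]
  refine Finset.sum_congr rfl fun a ha => ?_
  have haj : a ≤ j := Nat.lt_succ_iff.1 (Finset.mem_range.1 ha)
  have hqj : q ≤ j := Nat.lt_succ_iff.1 (Finset.mem_range.1 hq)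
  rw [Real.circleAverage_fun_smul, circleAverage_conj_pow_mul_pow_mul_exp,
    show j + 1 - 1 - a = j - a by omega]
  by_cases h : j ≤ a + q
  · rw [if_pos h, if_pos (by omega), Nat.choose_symm haj, ← Complex.conj_mul' z,
      ← Complex.conj_mul' w, show q - (j - a) = a + q - j by omega, show j - (j - a) = a by omega]
    have e1 : a = (j - q) + (a + q - j) := by omega
    have e2 : q = (j - a) + (a + q - j) := by omega
    simp only [starRingEnd_apply, smul_eq_mul]
    have e3 : (star z * z) ^ a = z ^ a * (star z ^ (j - q) * star z ^ (a + q - j)) := by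
      rw [← pow_add, ← e1]; ring
    have e4 : (star w * w) ^ q = star w ^ q * (w ^ (j - a) * w ^ (a + q - j)) := by
      rw [← pow_add, ← e2]; ring
    rw [e3, e4, neg_pow, mul_pow]
    ring
  · rw [if_neg h, if_neg (by omega), smul_zero]

/-- The product formula for Laguerre functions of order zero. -/
theorem circleAverage_laguerre_mul_exp (k : ℕ) (z w : ℂ) :
    Real.circleAverage (fun a => (laguerre 0 k (‖z + a * w‖ ^ 2) : ℂ) *
        Complex.exp (-(a * (star z * w)))) 0 1
      = (laguerre 0 k (‖z‖ ^ 2) : ℂ) * (laguerre 0 k (‖w‖ ^ 2) : ℂ) := by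
  have hL : ∀ x : ℝ, (laguerre 0 k x : ℂ) = ∑ j ∈ Finset.range (k + 1),
      ((-1) ^ j * (k.choose j : ℂ) / (j.factorial : ℂ)) * (x : ℂ) ^ j := by
    intro x
    rw [laguerre_zero_order]
    push_cast
    rfl
  simp only [hL, Complex.ofReal_pow]
  have h1 : ∀ a : ℂ, (∑ j ∈ Finset.range (k + 1),
        ((-1) ^ j * (k.choose j : ℂ) / (j.factorial : ℂ)) * (‖z + a * w‖ ^ 2 : ℂ) ^ j) *
        Complex.exp (-(a * (star z * w))) = ∑ j ∈ Finset.range (k + 1),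
        ((-1) ^ j * (k.choose j : ℂ) / (j.factorial : ℂ)) •
          ((‖z + a * w‖ ^ 2 : ℂ) ^ j * Complex.exp (-(a * (star z * w)))) := by
    intro a
    rw [Finset.sum_mul]
    exact Finset.sum_congr rfl fun j _ => by rw [smul_eq_mul, mul_assoc]
  simp only [h1]
  rw [Real.circleAverage_fun_sum fun j _ => ContinuousOn.circleIntegrable' (Continuous.continuousOn (by fun_prop)),
    Finset.sum_mul_sum, Finset.sum_comm]
  -- The inner ranges are extended to one independent of `j`, so that the sum over `j` can be
  -- carried out first; the added terms contain a vanishing binomial.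
  have h2 : ∀ j ∈ Finset.range (k + 1), ∀ F : ℕ → ℕ → ℂ,
      (∀ a b, (j < a ∨ j < b) → F a b = 0) →
      ∑ b ∈ Finset.range (j + 1), ∑ a ∈ Finset.range (j + 1), F a b
        = ∑ b ∈ Finset.range (k + 1), ∑ a ∈ Finset.range (k + 1), F a b := by
    intro j hj F hF
    have hsub : Finset.range (j + 1) ⊆ Finset.range (k + 1) :=
      Finset.range_subset_range.2 (by have := Finset.mem_range.1 hj; omega)
    rw [← Finset.sum_subset hsub]
    · refine Finset.sum_congr rfl fun b _ => Finset.sum_subset hsub fun a _ ha => ?_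
      exact hF a b (Or.inl (by have := mt Finset.mem_range.2 ha; omega))
    · intro b _ hb
      exact Finset.sum_eq_zero fun a _ =>
        hF a b (Or.inr (by have := mt Finset.mem_range.2 hb; omega))
  calc _ = ∑ j ∈ Finset.range (k + 1), ∑ b ∈ Finset.range (k + 1), ∑ a ∈ Finset.range (k + 1),
        (if j ≤ a + b then (-1 : ℂ) ^ j * k.choose j / j.factorial *
          (j.choose a * j.choose b * ((-1) ^ (a + b - j) / (a + b - j).factorial)) else 0) *
          ((‖z‖ ^ 2 : ℂ) ^ a * (‖w‖ ^ 2 : ℂ) ^ b) := by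
        refine Finset.sum_congr rfl fun j hj => ?_
        rw [Real.circleAverage_fun_smul, circleAverage_norm_pow_mul_exp, h2 j hj]
        · rw [smul_eq_mul, Finset.mul_sum]
          refine Finset.sum_congr rfl fun b _ => ?_
          rw [Finset.mul_sum]
          refine Finset.sum_congr rfl fun a _ => ?_
          split_ifs <;> ring
        · rintro a b (h | h) <;> simp [Nat.choose_eq_zero_of_lt h]
    _ = _ := by
        rw [Finset.sum_comm]
        refine Finset.sum_congr rfl fun b _ => ?_
        rw [Finset.sum_comm]
        refine Finset.sum_congr rfl fun a _ => ?_
        rw [← Finset.sum_mul, sum_choose_div_factorial]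
        ring

/-! ### Gaussian moments on `ℂⁿ` -/

/-- `|v|²` for the Hermitian norm on `ℂⁿ`. -/
def hermNormSq (v : Fin n → ℂ) : ℝ := ∑ i, ‖v i‖ ^ 2

theorem hermNormSq_nonneg (v : Fin n → ℂ) : 0 ≤ hermNormSq v :=
  Finset.sum_nonneg fun _ _ => sq_nonneg _

theorem normSqZ_eq (x : Heisenberg n) : x.normSqZ = hermNormSq x.z := rfl

theorem star_dotProduct_self (v : Fin n → ℂ) : star v ⬝ᵥ v = (hermNormSq v : ℂ) := by
  simp only [dotProduct, Pi.star_apply, hermNormSq, Complex.ofReal_sum, Complex.ofReal_pow]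
  exact Finset.sum_congr rfl fun i _ => Complex.conj_mul' _

theorem hermNormSq_unitary_mulVec (g : Matrix.unitaryGroup (Fin n) ℂ) (v : Fin n → ℂ) :
    hermNormSq ((g : Matrix (Fin n) (Fin n) ℂ) *ᵥ v) = hermNormSq v := by
  have h := star_unitary_mulVec_dotProduct g v v
  rw [star_dotProduct_self, star_dotProduct_self] at h
  exact_mod_cast h

theorem normSqZ_rotate (g : Matrix.unitaryGroup (Fin n) ℂ) (x : Heisenberg n) :
    (rotate g x).normSqZ = x.normSqZ := hermNormSq_unitary_mulVec g x.z

theorem continuous_hermNormSq : Continuous (hermNormSq : (Fin n → ℂ) → ℝ) := by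
  unfold hermNormSq
  fun_prop

theorem integral_complex_norm_pow_mul_gaussian (j : ℕ) :
    ∫ v : ℂ, (‖v‖ ^ 2) ^ j * Real.exp (-‖v‖ ^ 2) = Real.pi * j.factorial := by
  have h := Complex.integral_rpow_mul_exp_neg_rpow (p := 2) (q := ((2 * j : ℕ) : ℝ)) one_le_two
    (by have : (0 : ℝ) ≤ ((2 * j : ℕ) : ℝ) := Nat.cast_nonneg _
        linarith)
  simp only [Real.rpow_natCast, Real.rpow_two, pow_mul] at h
  rw [h, show (((2 * j : ℕ) : ℝ) + 2) / 2 = (j : ℝ) + 1 by push_cast; ring,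
    Real.Gamma_nat_eq_factorial]
  ring

/-- A nonintegrable function has Bochner integral `0`, whereas this integral is positive. -/
theorem integrable_complex_norm_pow_mul_gaussian (j : ℕ) :
    Integrable fun v : ℂ => (‖v‖ ^ 2) ^ j * Real.exp (-‖v‖ ^ 2) := by
  by_contra h
  have h1 := integral_complex_norm_pow_mul_gaussian j
  rw [integral_undef h] at h1
  have : 0 < Real.pi * (j.factorial : ℝ) :=
    mul_pos Real.pi_pos (by exact_mod_cast j.factorial_pos)
  linarith

theorem exp_neg_hermNormSq (v : Fin n → ℂ) :
    Real.exp (-hermNormSq v) = ∏ i, Real.exp (-‖v i‖ ^ 2) := by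
  rw [← Real.exp_sum, Finset.sum_neg_distrib]
  rfl

theorem integrable_monomial_mul_gaussian (k : Fin n → ℕ) :
    Integrable fun v : Fin n → ℂ => ∏ i, ((‖v i‖ ^ 2) ^ k i * Real.exp (-‖v i‖ ^ 2)) :=
  Integrable.fintype_prod_dep fun i => integrable_complex_norm_pow_mul_gaussian (k i)

theorem integral_monomial_mul_gaussian (k : Fin n → ℕ) :
    ∫ v : Fin n → ℂ, ∏ i, ((‖v i‖ ^ 2) ^ k i * Real.exp (-‖v i‖ ^ 2))
      = Real.pi ^ n * ∏ i, ((k i).factorial : ℝ) := by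
  rw [integral_fintype_prod_volume_eq_prod
    fun (i : Fin n) (w : ℂ) => (‖w‖ ^ 2) ^ k i * Real.exp (-‖w‖ ^ 2)]
  simp only [integral_complex_norm_pow_mul_gaussian, Finset.prod_mul_distrib, Finset.prod_const,
    Finset.card_univ, Fintype.card_fin]

theorem hermNormSq_pow_mul_gaussian_eq (j : ℕ) (v : Fin n → ℂ) :
    hermNormSq v ^ j * Real.exp (-hermNormSq v)
      = ∑ k ∈ Finset.piAntidiag Finset.univ j, (Nat.multinomial Finset.univ k : ℝ) *
        ∏ i, ((‖v i‖ ^ 2) ^ k i * Real.exp (-‖v i‖ ^ 2)) := by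
  rw [exp_neg_hermNormSq, hermNormSq, Finset.sum_pow_eq_sum_piAntidiag, Finset.sum_mul]
  refine Finset.sum_congr rfl fun k _ => ?_
  rw [Finset.prod_mul_distrib, mul_assoc]

theorem integrable_hermNormSq_pow_mul_gaussian (n j : ℕ) :
    Integrable fun v : Fin n → ℂ => hermNormSq v ^ j * Real.exp (-hermNormSq v) := by
  simp only [hermNormSq_pow_mul_gaussian_eq]
  exact integrable_finsetSum _ fun k _ => (integrable_monomial_mul_gaussian k).const_mul _

theorem card_piAntidiag_univ_fin (n j : ℕ) :
    (Finset.piAntidiag (Finset.univ : Finset (Fin n)) j).card = (n + j - 1).choose j := by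
  rw [← Finset.map_sym_eq_piAntidiag, Finset.card_map, Finset.sym_univ, Finset.card_univ,
    Sym.card_sym_eq_choose, Fintype.card_fin]

/-- In the multinomial expansion every multi-index contributes the same amount, as its multinomial
coefficient times `∏ kᵢ!` is `j!`; it remains to count the multi-indices. -/
theorem integral_hermNormSq_pow_mul_gaussian (n j : ℕ) :
    ∫ v : Fin n → ℂ, hermNormSq v ^ j * Real.exp (-hermNormSq v)
      = (n + j - 1).choose j * (Real.pi ^ n * j.factorial) := by
  simp only [hermNormSq_pow_mul_gaussian_eq]
  rw [integral_finsetSum _ fun k _ => (integrable_monomial_mul_gaussian k).const_mul _]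
  rw [Finset.sum_congr rfl (g := fun _ => Real.pi ^ n * (j.factorial : ℝ)), Finset.sum_const,
    card_piAntidiag_univ_fin, nsmul_eq_mul]
  intro k hk
  rw [integral_const_mul, integral_monomial_mul_gaussian]
  have h1 := Nat.multinomial_spec Finset.univ k
  rw [(Finset.mem_piAntidiag.1 hk).1] at h1
  have h2 : (∏ i, ((k i).factorial : ℝ)) * (Nat.multinomial Finset.univ k : ℝ)
      = (j.factorial : ℝ) := by exact_mod_cast h1
  rw [← h2]
  ring

theorem integral_coordinate_pow_mul_gaussian (i : Fin n) (j : ℕ) :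
    ∫ v : Fin n → ℂ, (‖v i‖ ^ 2) ^ j * Real.exp (-hermNormSq v)
      = Real.pi ^ n * j.factorial := by
  have h := integral_monomial_mul_gaussian (Pi.single i j : Fin n → ℕ)
  have e1 : ∀ v : Fin n → ℂ, ∏ i', (‖v i'‖ ^ 2) ^ (Pi.single i j : Fin n → ℕ) i'
      = (‖v i‖ ^ 2) ^ j := by
    intro v
    rw [Finset.prod_eq_single i]
    · simp
    · intro b _ hb
      simp [hb]
    · simp
  have e2 : ∏ i', (((Pi.single i j : Fin n → ℕ) i').factorial : ℝ) = j.factorial := by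
    rw [Finset.prod_eq_single i]
    · simp
    · intro b _ hb
      simp [hb]
    · simp
  simpa only [Finset.prod_mul_distrib, e1, e2, ← exp_neg_hermNormSq] using h

/-! ### Moments of invariant functions -/

/-- The unit vector `v / |v|` is extended to an orthonormal basis with that vector in position `i`;
the conjugated basis vectors are the rows of `g`. -/
theorem exists_unitary_row (i : Fin n) (v : Fin n → ℂ) :
    ∃ g : Matrix.unitaryGroup (Fin n) ℂ, ∀ w : Fin n → ℂ,
      ‖star v ⬝ᵥ w‖ ^ 2 = hermNormSq v * ‖((g : Matrix (Fin n) (Fin n) ℂ) *ᵥ w) i‖ ^ 2 := by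
  by_cases hv : v = 0
  · exact ⟨1, fun w => by simp [hv, hermNormSq]⟩
  set V : EuclideanSpace ℂ (Fin n) := WithLp.toLp 2 v with hV
  have hV0 : V ≠ 0 := by simpa [hV] using hv
  have hVn : ‖V‖ ≠ 0 := norm_ne_zero_iff.2 hV0
  have hVsq : ‖V‖ ^ 2 = hermNormSq v := by
    rw [EuclideanSpace.norm_sq_eq]
    rfl
  set U : EuclideanSpace ℂ (Fin n) := ((‖V‖⁻¹ : ℝ) : ℂ) • V with hU
  have hU1 : ‖U‖ = 1 := by
    rw [hU, norm_smul, Complex.norm_real, norm_inv, norm_norm, inv_mul_cancel₀ hVn]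
  have hon : Orthonormal ℂ (({i} : Set (Fin n)).domRestrict fun _ : Fin n => U) := by
    refine ⟨fun _ => hU1, ?_⟩
    intro a b hab
    exact absurd (Subsingleton.elim a b) hab
  obtain ⟨b, hb⟩ := hon.exists_orthonormalBasis_extension_of_card_eq (by simp)
  have hbi : b i = U := hb i rfl
  have hmem : (Matrix.of fun p q => star (b p q)) ∈ Matrix.unitaryGroup (Fin n) ℂ := by
    rw [Matrix.mem_unitaryGroup_iff]
    ext p q
    have h := orthonormal_iff_ite.1 b.orthonormal p q
    rw [PiLp.inner_apply] at h
    simp only [Matrix.mul_apply, Matrix.star_apply, Matrix.of_apply, star_star, Matrix.one_apply]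
    rw [← h]
    refine Finset.sum_congr rfl fun k _ => ?_
    simp [mul_comm]
  refine ⟨⟨_, hmem⟩, fun w => ?_⟩
  have hrow : ((Matrix.of fun p q => star (b p q)) *ᵥ w) i = ((‖V‖⁻¹ : ℝ) : ℂ) * (star v ⬝ᵥ w) := by
    simp only [Matrix.mulVec, dotProduct, Matrix.of_apply, hbi, hU, Finset.mul_sum]
    refine Finset.sum_congr rfl fun k _ => ?_
    simp [hV, mul_assoc]
  rw [hrow, norm_mul, mul_pow, Complex.norm_real, norm_inv, norm_norm, inv_pow, hVsq]
  rw [← mul_assoc, mul_inv_cancel₀ (by rw [← hVsq]; positivity), one_mul]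

theorem norm_star_dotProduct_comm (v w : Fin n → ℂ) : ‖star v ⬝ᵥ w‖ = ‖star w ⬝ᵥ v‖ := by
  rw [Matrix.star_dotProduct, norm_star]

/-- The Gaussian is unitarily invariant, so `w` may be rotated to a multiple of the `i`-th basis
vector. -/
theorem integral_dotProduct_pow_mul_gaussian (i : Fin n) (j : ℕ) (w : Fin n → ℂ) :
    ∫ v : Fin n → ℂ, (‖star v ⬝ᵥ w‖ ^ 2) ^ j * Real.exp (-hermNormSq v)
      = hermNormSq w ^ j * (Real.pi ^ n * j.factorial) := by
  obtain ⟨g, hg⟩ := exists_unitary_row i w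
  have h := (measurePreserving_unitary_mulVec g).integral_comp
    (MeasurableEquiv.measurableEmbedding
      { toFun := fun v => (g : Matrix (Fin n) (Fin n) ℂ) *ᵥ v
        invFun := fun v => ((g⁻¹ : Matrix.unitaryGroup (Fin n) ℂ) : Matrix (Fin n) (Fin n) ℂ) *ᵥ v
        left_inv := fun v => by
          simp only [Matrix.mulVec_mulVec]
          rw [← Submonoid.coe_mul, inv_mul_cancel]
          simp
        right_inv := fun v => by
          simp only [Matrix.mulVec_mulVec]
          rw [← Submonoid.coe_mul, mul_inv_cancel]
          simp
        measurable_toFun := (measurePreserving_unitary_mulVec g).measurable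
        measurable_invFun := (measurePreserving_unitary_mulVec g⁻¹).measurable })
    (fun v : Fin n → ℂ => (‖v i‖ ^ 2) ^ j * Real.exp (-hermNormSq v))
  rw [integral_coordinate_pow_mul_gaussian] at h
  rw [← h, ← integral_const_mul]
  refine integral_congr_ae (Filter.Eventually.of_forall fun v => ?_)
  beta_reduce
  rw [norm_star_dotProduct_comm, hg, hermNormSq_unitary_mulVec, mul_pow, mul_assoc]

theorem norm_star_dotProduct_sq_le (i : Fin n) (v w : Fin n → ℂ) :
    ‖star v ⬝ᵥ w‖ ^ 2 ≤ hermNormSq v * hermNormSq w := by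
  obtain ⟨g, hg⟩ := exists_unitary_row i v
  rw [hg, ← hermNormSq_unitary_mulVec g w]
  exact mul_le_mul_of_nonneg_left (Finset.single_le_sum (f := fun i =>
    ‖((g : Matrix (Fin n) (Fin n) ℂ) *ᵥ w) i‖ ^ 2) (fun _ _ => sq_nonneg _)
    (Finset.mem_univ i)) (hermNormSq_nonneg _)

theorem measurable_star_dotProduct_z :
    Measurable fun p : (Fin n → ℂ) × Heisenberg n => star p.1 ⬝ᵥ p.2.z := by
  have hd : Measurable fun p : (Fin n → ℂ) × (Fin n → ℂ) => star p.1 ⬝ᵥ p.2 :=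
    ((continuous_star.comp continuous_fst).dotProduct continuous_snd).measurable
  exact hd.comp (measurable_fst.prodMk (measurable_z.comp measurable_snd))

theorem integrable_dotProduct_pow_mul_gaussian (i : Fin n) (j : ℕ) {f : Heisenberg n → ℂ}
    (hfj : Integrable fun x => f x * ((hermNormSq x.z ^ j : ℝ) : ℂ))
    (hfm : AEStronglyMeasurable f) :
    Integrable (fun p : (Fin n → ℂ) × Heisenberg n =>
      f p.2 * (((‖star p.1 ⬝ᵥ p.2.z‖ ^ 2) ^ j : ℝ) : ℂ) * (Real.exp (-hermNormSq p.1) : ℂ))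
      (volume.prod volume) := by
  have hb := (integrable_hermNormSq_pow_mul_gaussian n j).norm.mul_prod hfj.norm
  have h1 : Measurable fun p : (Fin n → ℂ) × Heisenberg n =>
      (((‖star p.1 ⬝ᵥ p.2.z‖ ^ 2) ^ j : ℝ) : ℂ) :=
    Complex.measurable_ofReal.comp
      ((measurable_star_dotProduct_z.norm.pow_const 2).pow_const j)
  have h2 : Measurable fun p : (Fin n → ℂ) × Heisenberg n =>
      (Real.exp (-hermNormSq p.1) : ℂ) :=
    Complex.measurable_ofReal.comp (Real.measurable_exp.comp
      (continuous_hermNormSq.measurable.comp measurable_fst).neg)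
  refine hb.mono' ((hfm.comp_snd.mul h1.aestronglyMeasurable).mul h2.aestronglyMeasurable)
    (Filter.Eventually.of_forall fun p => ?_)
  have h3 := pow_le_pow_left₀ (sq_nonneg _) (norm_star_dotProduct_sq_le i p.1 p.2.z) j
  rw [mul_pow] at h3
  rw [norm_mul, norm_mul, norm_mul, norm_mul, Complex.norm_real, Complex.norm_real,
    Complex.norm_real, Real.norm_of_nonneg (Real.exp_pos _).le,
    Real.norm_of_nonneg (pow_nonneg (sq_nonneg _) _),
    Real.norm_of_nonneg (pow_nonneg (hermNormSq_nonneg _) _),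
    Real.norm_of_nonneg (pow_nonneg (hermNormSq_nonneg _) _)]
  calc ‖f p.2‖ * (‖star p.1 ⬝ᵥ p.2.z‖ ^ 2) ^ j * Real.exp (-hermNormSq p.1)
      ≤ ‖f p.2‖ * (hermNormSq p.1 ^ j * hermNormSq p.2.z ^ j) *
        Real.exp (-hermNormSq p.1) := by gcongr
    _ = _ := by ring

/-- For a unitarily invariant weight, `|z|^{2j}` and `|zᵢ|^{2j}` have proportional integrals. -/
theorem integral_mul_hermNormSq_pow (i : Fin n) (j : ℕ) {f : Heisenberg n → ℂ}
    (hf : UnitaryInvariant f) (hfj : Integrable fun x => f x * ((hermNormSq x.z ^ j : ℝ) : ℂ))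
    (hfm : AEStronglyMeasurable f) :
    ∫ x, f x * ((hermNormSq x.z ^ j : ℝ) : ℂ)
      = (n + j - 1).choose j * ∫ x, f x * (((‖x.z i‖ ^ 2) ^ j : ℝ) : ℂ) := by
  set M := ∫ x, f x * (((‖x.z i‖ ^ 2) ^ j : ℝ) : ℂ) with hM
  have hinner : ∀ v : Fin n → ℂ, ∫ x : Heisenberg n, f x * (((‖star v ⬝ᵥ x.z‖ ^ 2) ^ j : ℝ) : ℂ)
      = ((hermNormSq v ^ j : ℝ) : ℂ) * M := by
    intro v
    obtain ⟨g, hg⟩ := exists_unitary_row i v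
    rw [hM, ← hf.integral_mul_comp_rotate g fun x => (((‖x.z i‖ ^ 2) ^ j : ℝ) : ℂ),
      ← integral_const_mul]
    refine integral_congr_ae (Filter.Eventually.of_forall fun x => ?_)
    simp only [hg, mul_pow, rotate, z_mk]
    push_cast
    ring
  have hprod := integrable_dotProduct_pow_mul_gaussian i j hfj hfm
  -- The double integral of `f(x) |⟨v, z⟩|^{2j} exp(-|v|²)` is evaluated in both orders. Integrating
  -- first in `x`, invariance of `f` gives `|v|^{2j} M`; integrating first in `v`, the Gaussian
  -- gives `|z|^{2j} πⁿ j!`.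
  have hswap := integral_integral_swap (f := fun (v : Fin n → ℂ) (x : Heisenberg n) =>
      f x * (((‖star v ⬝ᵥ x.z‖ ^ 2) ^ j : ℝ) : ℂ) * (Real.exp (-hermNormSq v) : ℂ)) hprod
  have hL : ∀ v : Fin n → ℂ, ∫ x : Heisenberg n, f x * (((‖star v ⬝ᵥ x.z‖ ^ 2) ^ j : ℝ) : ℂ) *
      (Real.exp (-hermNormSq v) : ℂ)
      = M * ((hermNormSq v ^ j * Real.exp (-hermNormSq v) : ℝ) : ℂ) := by
    intro v
    rw [integral_mul_const, hinner]
    push_cast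
    ring
  have hR : ∀ x : Heisenberg n, ∫ v : Fin n → ℂ, f x * (((‖star v ⬝ᵥ x.z‖ ^ 2) ^ j : ℝ) : ℂ) *
      (Real.exp (-hermNormSq v) : ℂ)
      = f x * ((hermNormSq x.z ^ j : ℝ) : ℂ) * ((Real.pi ^ n * j.factorial : ℝ) : ℂ) := by
    intro x
    have := congrArg (fun r : ℝ => (r : ℂ)) (integral_dotProduct_pow_mul_gaussian i j x.z)
    simp only [Complex.ofReal_mul] at this
    simp only [mul_assoc]
    rw [integral_const_mul, Complex.ofReal_mul, ← this, ← integral_complex_ofReal]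
    simp only [Complex.ofReal_mul]
  simp only [hL, hR] at hswap
  rw [integral_const_mul, integral_mul_const, integral_complex_ofReal,
    integral_hermNormSq_pow_mul_gaussian] at hswap
  have hne : ((Real.pi ^ n * j.factorial : ℝ) : ℂ) ≠ 0 := by
    exact_mod_cast mul_ne_zero (pow_ne_zero _ Real.pi_ne_zero) (Nat.cast_ne_zero.2
      j.factorial_ne_zero)
  refine mul_right_cancel₀ hne (hswap.symm.trans ?_)
  push_cast
  ring

/-! ### The Gaussian character and its bounds -/

/-- The function `exp(-i l s) exp(-|l| |z|² / 4)`. -/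
def gaussianCharacter (l : ℝ) (x : Heisenberg n) : ℂ :=
  Complex.exp (-(Complex.I * l * x.s)) * (Real.exp (-(|l| / 4) * x.normSqZ) : ℂ)

theorem measurable_normSqZ : Measurable (normSqZ : Heisenberg n → ℝ) :=
  continuous_hermNormSq.measurable.comp measurable_z

theorem measurable_gaussianCharacter (l : ℝ) :
    Measurable (gaussianCharacter l : Heisenberg n → ℂ) := by
  have h1 := measurable_s (n := n)
  have h2 := measurable_normSqZ (n := n)
  unfold gaussianCharacter
  fun_prop

theorem norm_gaussianCharacter (l : ℝ) (x : Heisenberg n) :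
    ‖gaussianCharacter l x‖ = Real.exp (-(|l| / 4) * x.normSqZ) := by
  rw [gaussianCharacter, norm_mul, Complex.norm_real, Real.norm_of_nonneg (Real.exp_pos _).le,
    show -(Complex.I * l * x.s) = ((-(l * x.s) : ℝ) : ℂ) * Complex.I by push_cast; ring,
    Complex.norm_exp_ofReal_mul_I, one_mul]

theorem gaussianCharacter_rotate (l : ℝ) (g : Matrix.unitaryGroup (Fin n) ℂ) (x : Heisenberg n) :
    gaussianCharacter l (rotate g x) = gaussianCharacter l x := by
  rw [gaussianCharacter, normSqZ_rotate]
  rfl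

/-- A single term of the exponential series is bounded by `exp(b x)`. -/
theorem pow_mul_exp_neg_le {b x : ℝ} (hb : 0 < b) (hx : 0 ≤ x) (j : ℕ) :
    x ^ j * Real.exp (-b * x) ≤ j.factorial * b⁻¹ ^ j := by
  have h := Real.pow_div_factorial_le_exp (x := b * x) (by positivity) j
  have hf : (0 : ℝ) < j.factorial := by exact_mod_cast j.factorial_pos
  rw [div_le_iff₀ hf, mul_pow] at h
  rw [neg_mul, Real.exp_neg, ← div_eq_mul_inv, div_le_iff₀ (Real.exp_pos _), inv_pow]
  have hbj : 0 < b ^ j := pow_pos hb j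
  calc x ^ j = (b ^ j)⁻¹ * (b ^ j * x ^ j) := by field_simp
    _ ≤ (b ^ j)⁻¹ * (Real.exp (b * x) * j.factorial) := by gcongr
    _ = _ := by ring

theorem norm_gaussianCharacter_mul_pow_le {l : ℝ} (hl : l ≠ 0) (j : ℕ) {x : Heisenberg n} {r : ℝ}
    (hr0 : 0 ≤ r) (hr : r ≤ x.normSqZ) :
    ‖gaussianCharacter l x * ((r ^ j : ℝ) : ℂ)‖ ≤ j.factorial * (|l| / 4)⁻¹ ^ j := by
  have hl' : 0 < |l| / 4 := by positivity
  rw [norm_mul, norm_gaussianCharacter, Complex.norm_real, Real.norm_of_nonneg (pow_nonneg hr0 j),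
    mul_comm]
  refine le_trans ?_ (pow_mul_exp_neg_le hl' (hr0.trans hr) j)
  gcongr

theorem norm_sq_z_le_normSqZ (i : Fin n) (x : Heisenberg n) : ‖x.z i‖ ^ 2 ≤ x.normSqZ :=
  Finset.single_le_sum (f := fun i => ‖x.z i‖ ^ 2) (fun _ _ => sq_nonneg _) (Finset.mem_univ i)

theorem normSqZ_nonneg (x : Heisenberg n) : 0 ≤ x.normSqZ := hermNormSq_nonneg _

/-! ### A diagonal matrix coefficient with the same integrals as the spherical function -/

/-- The inverse of the diagonal coefficient, at the normalized monomial `ζᵢᵏ`, of the Fock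
representation of parameter `l`. -/
def fockCoefficient (i : Fin n) (l : ℝ) (k : ℕ) (x : Heisenberg n) : ℂ :=
  gaussianCharacter l x * (laguerre 0 k (|l| / 2 * ‖x.z i‖ ^ 2) : ℂ)

theorem fockCoefficient_eq_sum (i : Fin n) (l : ℝ) (k : ℕ) (x : Heisenberg n) :
    fockCoefficient i l k x = ∑ j ∈ Finset.range (k + 1),
      ((-1) ^ j * (k.choose j : ℂ) / (j.factorial : ℂ) * ((|l| / 2 : ℝ) : ℂ) ^ j) *
        (gaussianCharacter l x * (((‖x.z i‖ ^ 2) ^ j : ℝ) : ℂ)) := by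
  rw [fockCoefficient, laguerre_zero_order]
  push_cast
  rw [Finset.mul_sum]
  refine Finset.sum_congr rfl fun j _ => ?_
  rw [mul_pow]
  ring

theorem laguerre_apply_zero (a k : ℕ) : laguerre a k 0 = (k + a).choose k := by
  rw [laguerre, Finset.sum_eq_single 0]
  · simp
  · intro j _ hj
    simp [hj]
  · simp

theorem sphericalFunction_inv_eq_sum (l : ℝ) (k : ℕ) (x : Heisenberg n) :
    sphericalFunction l k x⁻¹ = ∑ j ∈ Finset.range (k + 1),
      ((-1) ^ j * (((k + (n - 1)).choose (k - j) : ℂ) / ((k + (n - 1)).choose k : ℂ)) /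
        (j.factorial : ℂ) * ((|l| / 2 : ℝ) : ℂ) ^ j) *
        (gaussianCharacter l x * ((hermNormSq x.z ^ j : ℝ) : ℂ)) := by
  have h1 : (x⁻¹).normSqZ = x.normSqZ := by simp [normSqZ, inv_def]
  have h2 : Complex.exp (Complex.I * l * ((x⁻¹).s : ℂ)) = Complex.exp (-(Complex.I * l * x.s)) := by
    simp [inv_def]
  rw [sphericalFunction, h1, h2, laguerreNormalized, laguerre_apply_zero, laguerre,
    gaussianCharacter, normSqZ_eq]
  push_cast
  rw [Finset.sum_div, Finset.mul_sum, Finset.sum_mul]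
  refine Finset.sum_congr rfl fun j _ => ?_
  rw [mul_pow]
  ring

/-- Choosing a subset of a subset in two ways. Multiplied by the moment factor `C(n+j-1, j)`, the
normalized Laguerre coefficients of order `n - 1` become those of order `0`. -/
theorem choose_ratio (hn : 1 ≤ n) {j k : ℕ} (hj : j ≤ k) :
    ((k + (n - 1)).choose (k - j) : ℂ) / ((k + (n - 1)).choose k : ℂ) * ((n + j - 1).choose j : ℂ)
      = (k.choose j : ℂ) := by
  have h := Nat.choose_mul (n := k + (n - 1)) (k := k) (s := k - j) (Nat.sub_le k j)
  rw [Nat.choose_symm hj, show k + (n - 1) - (k - j) = n + j - 1 by omega,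
    show k - (k - j) = j by omega] at h
  have h0 : ((k + (n - 1)).choose k : ℂ) ≠ 0 := by
    exact_mod_cast (Nat.choose_pos (Nat.le_add_right k (n - 1))).ne'
  have h' : ((k + (n - 1)).choose k : ℂ) * (k.choose j : ℂ)
      = ((k + (n - 1)).choose (k - j) : ℂ) * ((n + j - 1).choose j : ℂ) := by exact_mod_cast h
  rw [div_mul_eq_mul_div, ← h', mul_div_cancel_left₀ _ h0]

theorem measurable_fockCoefficient (i : Fin n) (l : ℝ) (k : ℕ) :
    Measurable (fockCoefficient i l k) := by
  have h1 := measurable_z_apply (n := n) i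
  have h2 := measurable_gaussianCharacter (n := n) l
  have h3 : Continuous (laguerre 0 k) := by
    unfold laguerre
    fun_prop
  refine h2.mul (Complex.measurable_ofReal.comp (h3.measurable.comp ?_))
  exact (h1.norm.pow_const 2).const_mul _

theorem exists_norm_fockCoefficient_le (i : Fin n) {l : ℝ} (hl : l ≠ 0) (k : ℕ) :
    ∃ C, ∀ x : Heisenberg n, ‖fockCoefficient i l k x‖ ≤ C := by
  refine ⟨∑ j ∈ Finset.range (k + 1),
    ‖(-1) ^ j * (k.choose j : ℂ) / (j.factorial : ℂ) * ((|l| / 2 : ℝ) : ℂ) ^ j‖ *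
      (j.factorial * (|l| / 4)⁻¹ ^ j), fun x => ?_⟩
  rw [fockCoefficient_eq_sum]
  refine norm_sum_le_of_le _ fun j _ => ?_
  rw [norm_mul]
  exact mul_le_mul_of_nonneg_left (norm_gaussianCharacter_mul_pow_le hl j (sq_nonneg _)
    (norm_sq_z_le_normSqZ i x)) (norm_nonneg _)

theorem measurable_sphericalFunction_inv (l : ℝ) (k : ℕ) :
    Measurable fun x : Heisenberg n => sphericalFunction l k x⁻¹ := by
  have h1 : Measurable fun x : Heisenberg n => hermNormSq x.z := measurable_normSqZ
  have h2 := measurable_gaussianCharacter (n := n) l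
  simp only [sphericalFunction_inv_eq_sum]
  fun_prop

theorem exists_norm_sphericalFunction_inv_le {l : ℝ} (hl : l ≠ 0) (k : ℕ) :
    ∃ C, ∀ x : Heisenberg n, ‖sphericalFunction l k x⁻¹‖ ≤ C := by
  refine ⟨∑ j ∈ Finset.range (k + 1),
    ‖(-1) ^ j * (((k + (n - 1)).choose (k - j) : ℂ) / ((k + (n - 1)).choose k : ℂ)) /
      (j.factorial : ℂ) * ((|l| / 2 : ℝ) : ℂ) ^ j‖ * (j.factorial * (|l| / 4)⁻¹ ^ j), fun x => ?_⟩
  rw [sphericalFunction_inv_eq_sum]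
  refine norm_sum_le_of_le _ fun j _ => ?_
  rw [norm_mul]
  exact mul_le_mul_of_nonneg_left (norm_gaussianCharacter_mul_pow_le hl j (normSqZ_nonneg x)
    le_rfl) (norm_nonneg _)

/-- On invariant functions the spherical transform is integration against a diagonal
coefficient of the Fock representation. -/
theorem sphericalTransform_eq_integral_fockCoefficient (hn : 1 ≤ n) (i : Fin n) {l : ℝ}
    (hl : l ≠ 0) (k : ℕ) {f : Heisenberg n → ℂ} (hf : Integrable f) (hfi : UnitaryInvariant f) :
    sphericalTransform f l k = ∫ x, f x * fockCoefficient i l k x := by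
  have hE := measurable_gaussianCharacter (n := n) l
  have hint : ∀ (j : ℕ) (r : Heisenberg n → ℝ), Measurable r → (∀ x, 0 ≤ r x) →
      (∀ x, r x ≤ x.normSqZ) →
      Integrable fun x => f x * (gaussianCharacter l x * ((r x ^ j : ℝ) : ℂ)) := by
    intro j r hr h0 h1
    refine hf.mul_bdd (c := j.factorial * (|l| / 4)⁻¹ ^ j) ?_ (Filter.Eventually.of_forall fun x =>
      norm_gaussianCharacter_mul_pow_le hl j (h0 x) (h1 x))
    exact (hE.mul (Complex.measurable_ofReal.comp (hr.pow_const j))).aestronglyMeasurable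
  have hN := fun j => hint j (fun x => hermNormSq x.z) measurable_normSqZ normSqZ_nonneg
    fun x => le_rfl
  have hi := fun j => hint j (fun x => ‖x.z i‖ ^ 2) ((measurable_z_apply i).norm.pow_const 2)
    (fun x => sq_nonneg _) (norm_sq_z_le_normSqZ i)
  -- The Gaussian character is itself invariant, so it can be absorbed into the weight whose moments
  -- are compared.
  have hfE : UnitaryInvariant fun x => f x * gaussianCharacter l x := by
    intro g
    filter_upwards [hfi g] with x hx
    rw [hx, gaussianCharacter_rotate]
  simp only [sphericalTransform, sphericalFunction_inv_eq_sum, fockCoefficient_eq_sum,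
    Finset.mul_sum, mul_left_comm (f _) (_ / _ * _)]
  rw [integral_finsetSum _ fun j _ => (hN j).const_mul _,
    integral_finsetSum _ fun j _ => (hi j).const_mul _]
  refine Finset.sum_congr rfl fun j hj => ?_
  rw [integral_const_mul, integral_const_mul]
  simp only [← mul_assoc (f _)] at hN ⊢
  rw [integral_mul_hermNormSq_pow i j hfE (hN j)
    (hf.aestronglyMeasurable.mul hE.aestronglyMeasurable),
    ← choose_ratio hn (Nat.lt_succ_iff.1 (Finset.mem_range.1 hj))]
  ring

/-! ### The product formula on torus averages -/

theorem mem_unitaryGroup_diagonal_circleMap (S : Set (Fin n)) [DecidablePred (· ∈ S)] (θ : ℝ) :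
    Matrix.diagonal (fun j => if j ∈ S then circleMap 0 1 θ else 1)
      ∈ Matrix.unitaryGroup (Fin n) ℂ := by
  rw [Matrix.mem_unitaryGroup_iff, Matrix.star_eq_conjTranspose, Matrix.diagonal_conjTranspose,
    Matrix.diagonal_mul_diagonal, ← Matrix.diagonal_one]
  congr 1
  ext j
  split_ifs with h
  · have := Complex.mul_conj' (circleMap 0 1 θ)
    simpa [h] using this
  · simp [h]

open scoped Classical in
/-- The rotation by the phase `e^{iθ}` in the coordinates that lie in `S`. -/
def phaseRotation (S : Set (Fin n)) (θ : ℝ) : Matrix.unitaryGroup (Fin n) ℂ :=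
  ⟨_, mem_unitaryGroup_diagonal_circleMap S θ⟩

open scoped Classical in
theorem rotate_phaseRotation (S : Set (Fin n)) (θ : ℝ) (x : Heisenberg n) :
    rotate (phaseRotation S θ) x
      = mk (fun j => (if j ∈ S then circleMap 0 1 θ else 1) * x.z j) x.s := by
  ext1
  · ext j
    simp only [rotate, phaseRotation, z_mk, Matrix.mulVec_diagonal]
  · rfl

theorem measurable_rotate_phaseRotation (S : Set (Fin n)) :
    Measurable fun p : ℝ × Heisenberg n => rotate (phaseRotation S p.1) p.2 := by
  classical
  simp only [rotate_phaseRotation]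
  refine measurable_mk (measurable_pi_lambda _ fun j => ?_) (measurable_s.comp measurable_snd)
  refine Measurable.mul ?_ ((measurable_z_apply j).comp measurable_snd)
  split_ifs
  · exact (continuous_circleMap 0 1).measurable.comp measurable_fst
  · exact measurable_const

/-- In an integral against an invariant function, the other factor may be averaged over phase
rotations. -/
theorem integral_mul_eq_of_phase_average {f K K' : Heisenberg n → ℂ} (hf : Integrable f)
    (hfi : UnitaryInvariant f) (hK : Measurable K) {C : ℝ} (hC : ∀ x, ‖K x‖ ≤ C)
    (S : Set (Fin n))
    (hav : ∀ x, (2 * Real.pi)⁻¹ • ∫ θ in (0 : ℝ)..2 * Real.pi, K (rotate (phaseRotation S θ) x)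
      = K' x) :
    (∫ x, f x * K x = ∫ x, f x * K' x) ∧ ∀ x, ‖K' x‖ ≤ C := by
  have h2pi : (0 : ℝ) < 2 * Real.pi := Real.two_pi_pos
  constructor
  · have hprod : Integrable (fun p : ℝ × Heisenberg n =>
        f p.2 * K (rotate (phaseRotation S p.1) p.2))
        ((volume.restrict (Set.Ioc 0 (2 * Real.pi))).prod volume) := by
      refine (hf.comp_snd _).mul_bdd (c := C) ?_ (Filter.Eventually.of_forall fun p => hC _)
      exact (hK.comp (measurable_rotate_phaseRotation S)).aestronglyMeasurable
    have hswap := integral_integral_swap (f := fun (θ : ℝ) (x : Heisenberg n) =>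
      f x * K (rotate (phaseRotation S θ) x)) hprod
    simp only [hfi.integral_mul_comp_rotate, integral_const_mul] at hswap
    have hR : ∀ x, f x * ∫ θ in Set.Ioc 0 (2 * Real.pi), K (rotate (phaseRotation S θ) x)
        = (2 * Real.pi : ℝ) • (f x * K' x) := by
      intro x
      rw [← hav x, ← intervalIntegral.integral_of_le h2pi.le, mul_smul_comm, smul_smul,
        mul_inv_cancel₀ h2pi.ne', one_smul]
    simp only [hR] at hswap
    rw [integral_smul, setIntegral_const, Real.volume_real_Ioc_of_le h2pi.le, sub_zero] at hswap
    exact smul_right_injective ℂ h2pi.ne' hswap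
  · intro x
    rw [← hav x, norm_smul, norm_inv, Real.norm_of_nonneg h2pi.le, inv_mul_le_iff₀ h2pi, mul_comm (2 * Real.pi) C]
    have := intervalIntegral.norm_integral_le_of_norm_le_const (a := 0) (b := 2 * Real.pi)
      (f := fun θ => K (rotate (phaseRotation S θ) x)) (C := C) fun θ _ => hC _
    rwa [sub_zero, abs_of_pos h2pi] at this

/-- The real part of `⟨z, w⟩` comes from expanding `|z + w|²` in the Gaussian, the imaginary part
from the group law. For `l > 0` they combine to `-(l/2) ⟨z, w⟩`, which is holomorphic in `w`; the
averages over phases depend on this. -/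
theorem fockCoefficient_mul_of_pos (i : Fin n) {l : ℝ} (hl : 0 < l) (k : ℕ) (x y : Heisenberg n) :
    fockCoefficient i l k (x * y) = gaussianCharacter l x * gaussianCharacter l y *
      ((laguerre 0 k (l / 2 * ‖x.z i + y.z i‖ ^ 2) : ℂ) *
        Complex.exp (-((l / 2 : ℝ) * (star x.z ⬝ᵥ y.z)))) := by
  have hN : (hermNormSq (x.z + y.z) : ℂ) = hermNormSq x.z + hermNormSq y.z +
      2 * ((star x.z ⬝ᵥ y.z).re : ℂ) := by
    have h1 : star y.z ⬝ᵥ x.z = star (star x.z ⬝ᵥ y.z) := Matrix.star_dotProduct _ _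
    rw [← star_dotProduct_self, star_add, add_dotProduct, dotProduct_add, dotProduct_add,
      star_dotProduct_self, star_dotProduct_self, h1]
    have h2 := Complex.add_conj (star x.z ⬝ᵥ y.z)
    rw [starRingEnd_apply] at h2
    push_cast at h2
    linear_combination h2
  have hz : (x * y).z = x.z + y.z := rfl
  have hs : (x * y).s = x.s + y.s + (1 / 2) * (star x.z ⬝ᵥ y.z).im := rfl
  have hE : gaussianCharacter l (x * y) = gaussianCharacter l x * gaussianCharacter l y *
      Complex.exp (-((l / 2 : ℝ) * (star x.z ⬝ᵥ y.z))) := by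
    simp only [gaussianCharacter, abs_of_pos hl, normSqZ_eq, hz, hs, Complex.ofReal_exp,
      ← Complex.exp_add]
    congr 1
    push_cast
    rw [hN]
    have h3 := Complex.re_add_im (star x.z ⬝ᵥ y.z)
    linear_combination -(l / 2 : ℂ) * h3
  rw [fockCoefficient, hE, abs_of_pos hl, hz, Pi.add_apply]
  ring

theorem star_dotProduct_eq_add_sum (i : Fin n) (v w : Fin n → ℂ) :
    star v ⬝ᵥ w = star (v i) * w i + ∑ j ∈ Finset.univ.erase i, star (v j) * w j :=
  (Finset.add_sum_erase Finset.univ (fun j => star (v j) * w j) (Finset.mem_univ i)).symm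

theorem circleAverage_laguerre_scaled_mul_exp (k : ℕ) {c : ℝ} (hc : 0 ≤ c) (z w : ℂ) :
    Real.circleAverage (fun a => (laguerre 0 k (c * ‖z + a * w‖ ^ 2) : ℂ) *
        Complex.exp (-(c * (a * (star z * w))))) 0 1
      = (laguerre 0 k (c * ‖z‖ ^ 2) : ℂ) * (laguerre 0 k (c * ‖w‖ ^ 2) : ℂ) := by
  have h := circleAverage_laguerre_mul_exp k (√c * z) (√c * w)
  have hs : ((√c : ℝ) : ℂ) * ((√c : ℝ) : ℂ) = c := by
    rw [← Complex.ofReal_mul, Real.mul_self_sqrt hc]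
  have e1 : ∀ v : ℂ, ‖(√c : ℂ) * v‖ ^ 2 = c * ‖v‖ ^ 2 := by
    intro v
    rw [norm_mul, mul_pow, Complex.norm_real, Real.norm_eq_abs, sq_abs, Real.sq_sqrt hc]
  have e2 : ∀ a : ℂ, (√c : ℂ) * z + a * ((√c : ℂ) * w) = (√c : ℂ) * (z + a * w) := fun a => by ring
  have e3 : ∀ a : ℂ, a * (star ((√c : ℂ) * z) * ((√c : ℂ) * w)) = c * (a * (star z * w)) := by
    intro a
    rw [← hs, star_mul', Complex.star_def, Complex.conj_ofReal]
    ring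
  simpa only [e2, e1, e3] using h

theorem integral_mul_fockCoefficient_of_pos (i : Fin n) {l : ℝ} (hl : 0 < l) (k : ℕ)
    {u : Heisenberg n → ℂ} (hu : Integrable u) (hui : UnitaryInvariant u) (x : Heisenberg n) :
    ∫ y, u y * fockCoefficient i l k (x * y)
      = fockCoefficient i l k x * ∫ y, u y * fockCoefficient i l k y := by
  obtain ⟨C, hC⟩ := exists_norm_fockCoefficient_le i hl.ne' k
  -- The result of the first average: in the exponent of `χ(xy)` only the `i`-th term of `⟨x.z,
  -- y.z⟩` survives.
  set K₁ : Heisenberg n → ℂ := fun y => gaussianCharacter l x * gaussianCharacter l y *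
    ((laguerre 0 k (l / 2 * ‖x.z i + y.z i‖ ^ 2) : ℂ) *
      Complex.exp (-((l / 2 : ℝ) * (star (x.z i) * y.z i)))) with hK₁
  have hav₁ : ∀ y, (2 * Real.pi)⁻¹ • ∫ θ in (0 : ℝ)..2 * Real.pi,
      fockCoefficient i l k (x * rotate (phaseRotation {i}ᶜ θ) y) = K₁ y := by
    intro y
    set ρ := ∑ j ∈ Finset.univ.erase i, star (x.z j) * y.z j with hρ
    have e : ∀ θ : ℝ, fockCoefficient i l k (x * rotate (phaseRotation {i}ᶜ θ) y)
        = K₁ y * Complex.exp (-(circleMap 0 1 θ * ((l / 2 : ℝ) * ρ))) := by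
      intro θ
      rw [fockCoefficient_mul_of_pos i hl, gaussianCharacter_rotate]
      have e1 : (rotate (phaseRotation {i}ᶜ θ) y).z i = y.z i := by
        simp [rotate_phaseRotation]
      have e2 : star x.z ⬝ᵥ (rotate (phaseRotation {i}ᶜ θ) y).z
          = star (x.z i) * y.z i + circleMap 0 1 θ * ρ := by
        rw [star_dotProduct_eq_add_sum i, e1, hρ, Finset.mul_sum]
        congr 1
        refine Finset.sum_congr rfl fun j hj => ?_
        have hji : j ≠ i := Finset.ne_of_mem_erase hj
        simp only [rotate_phaseRotation, z_mk, Set.mem_compl_iff, Set.mem_singleton_iff, hji,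
          not_false_eq_true, if_true]
        ring
      rw [e1, e2, hK₁]
      simp only
      rw [show -((l / 2 : ℝ) * (star (x.z i) * y.z i + circleMap 0 1 θ * ρ))
        = -((l / 2 : ℝ) * (star (x.z i) * y.z i)) + -(circleMap 0 1 θ * ((l / 2 : ℝ) * ρ)) by ring,
        Complex.exp_add]
      ring
    simp only [e]
    rw [intervalIntegral.integral_const_mul, ← mul_smul_comm, ← Real.circleAverage_def (f := fun a =>
      Complex.exp (-(a * ((l / 2 : ℝ) * ρ)))), circleAverage_exp_mul, mul_one]
  -- The remaining phase, that of `yᵢ`, enters only through the Laguerre product formula, here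
  -- scaled by `l / 2`.
  have hav₂ : ∀ y, (2 * Real.pi)⁻¹ • ∫ θ in (0 : ℝ)..2 * Real.pi,
      K₁ (rotate (phaseRotation {i} θ) y) = fockCoefficient i l k x * fockCoefficient i l k y := by
    intro y
    have e : ∀ θ : ℝ, K₁ (rotate (phaseRotation {i} θ) y)
        = gaussianCharacter l x * gaussianCharacter l y *
          ((laguerre 0 k (l / 2 * ‖x.z i + circleMap 0 1 θ * y.z i‖ ^ 2) : ℂ) *
          Complex.exp (-((l / 2 : ℝ) * (circleMap 0 1 θ * (star (x.z i) * y.z i))))) := by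
      intro θ
      have e1 : (rotate (phaseRotation {i} θ) y).z i = circleMap 0 1 θ * y.z i := by
        simp [rotate_phaseRotation]
      rw [hK₁]
      simp only [gaussianCharacter_rotate, e1]
      rw [mul_left_comm (star (x.z i))]
    simp only [e]
    rw [intervalIntegral.integral_const_mul, ← mul_smul_comm, ← Real.circleAverage_def (f := fun a =>
      (laguerre 0 k (l / 2 * ‖x.z i + a * y.z i‖ ^ 2) : ℂ) *
        Complex.exp (-((l / 2 : ℝ) * (a * (star (x.z i) * y.z i))))),
      circleAverage_laguerre_scaled_mul_exp k (by positivity), fockCoefficient, fockCoefficient,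
      abs_of_pos hl]
    ring
  have hm₁ : Measurable fun y => fockCoefficient i l k (x * y) :=
    (measurable_fockCoefficient i l k).comp (measurable_const_mul x)
  have hm₂ : Measurable K₁ := by
    have h1 := measurable_z_apply (n := n) i
    have h2 := measurable_gaussianCharacter (n := n) l
    have h3 : Measurable (laguerre 0 k) := by
      unfold laguerre
      fun_prop
    have h4 : Measurable fun y : Heisenberg n => laguerre 0 k (l / 2 * ‖x.z i + y.z i‖ ^ 2) :=
      h3.comp (by fun_prop)
    rw [hK₁]
    fun_prop
  -- The bound is inherited by the average `K₁`, which permits averaging a second time.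
  obtain ⟨h1, hC₁⟩ := integral_mul_eq_of_phase_average hu hui hm₁ (fun y => hC (x * y)) {i}ᶜ hav₁
  obtain ⟨h2, -⟩ := integral_mul_eq_of_phase_average hu hui hm₂ hC₁ {i} hav₂
  rw [h1, h2, ← integral_const_mul]
  simp only [mul_left_comm (fockCoefficient i l k x)]

theorem fockCoefficient_neg (i : Fin n) (l : ℝ) (k : ℕ) (x : Heisenberg n) :
    fockCoefficient i (-l) k x = starRingEnd ℂ (fockCoefficient i l k x) := by
  simp only [fockCoefficient, gaussianCharacter, abs_neg, map_mul, Complex.conj_ofReal,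
    ← Complex.exp_conj, map_neg, Complex.conj_I, Complex.ofReal_neg]
  ring_nf

/-- Conjugation exchanges `l` and `-l` and preserves invariance, so negative `l` follows from the
positive case applied to the conjugate of `u`. -/
theorem integral_mul_fockCoefficient (i : Fin n) {l : ℝ} (hl : l ≠ 0) (k : ℕ)
    {u : Heisenberg n → ℂ} (hu : Integrable u) (hui : UnitaryInvariant u) (x : Heisenberg n) :
    ∫ y, u y * fockCoefficient i l k (x * y)
      = fockCoefficient i l k x * ∫ y, u y * fockCoefficient i l k y := by
  rcases lt_or_gt_of_ne hl with h | h
  · have hconj : Integrable fun y => starRingEnd ℂ (u y) :=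
      (Complex.conjCLE : ℂ →L[ℝ] ℂ).integrable_comp hu
    have hinv : UnitaryInvariant fun y => starRingEnd ℂ (u y) := by
      intro g
      filter_upwards [hui g] with y hy
      rw [hy]
    have := congrArg (starRingEnd ℂ)
      (integral_mul_fockCoefficient_of_pos i (neg_pos.2 h) k hconj hinv x)
    simpa only [map_mul, ← integral_conj, fockCoefficient_neg, Complex.conj_conj] using this
  · exact integral_mul_fockCoefficient_of_pos i h k hu hui x

/-- The spherical transform is multiplicative on invariant functions. -/
theorem sphericalTransform_conv (hn : 1 ≤ n) {l : ℝ} (hl : l ≠ 0) (k : ℕ) {J : Heisenberg n → ℝ}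
    {u : Heisenberg n → ℂ} (hJ : Integrable J) (hJi : UnitaryInvariant J) (hu : Integrable u)
    (hui : UnitaryInvariant u) :
    sphericalTransform (conv J u) l k
      = sphericalTransform (fun x => (J x : ℂ)) l k * sphericalTransform u l k := by
  let i : Fin n := ⟨0, hn⟩
  have hJi' : UnitaryInvariant fun x => (J x : ℂ) := by
    intro g
    filter_upwards [hJi g] with x hx
    rw [hx]
  obtain ⟨C, hC⟩ := exists_norm_fockCoefficient_le i hl k
  rw [sphericalTransform_eq_integral_fockCoefficient hn i hl k (integrable_conv hJ hu)
      (UnitaryInvariant.conv hJi hui),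
    sphericalTransform_eq_integral_fockCoefficient hn i hl k
      (f := fun x => (J x : ℂ)) hJ.ofReal hJi',
    sphericalTransform_eq_integral_fockCoefficient hn i hl k hu hui,
    integral_conv_mul hJ hu (measurable_fockCoefficient i l k) hC]
  simp only [integral_mul_fockCoefficient i hl k hu hui]
  rw [← integral_mul_const]
  simp only [mul_assoc]

end Heisenberg

end

noncomputable section

/-! ### Exponentials of bounded operators and linear equations -/

section ExponentialOfOperator

variable {X : Type*} [NormedAddCommGroup X] [NormedSpace ℂ X]

theorem hasSum_exp_smul_apply [CompleteSpace X] (A : X →L[ℂ] X) (t : ℂ) (x : X) :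
    HasSum (fun m : ℕ => ((m.factorial : ℂ)⁻¹ * t ^ m) • (A ^ m) x)
      (NormedSpace.exp (t • A) x) := by
  have h := (NormedSpace.exp_series_hasSum_exp' (𝕂 := ℂ) (t • A)).mapL
    (ContinuousLinearMap.apply ℂ X x)
  simpa only [smul_pow, ContinuousLinearMap.apply_apply, smul_apply,
    smul_smul] using h

/-- The partial sums of the exponential series stay in `V`, and `V` is closed. -/
theorem Submodule.exp_smul_apply_mem [CompleteSpace X] (A : X →L[ℂ] X) {V : Submodule ℂ X}
    (hV : IsClosed (V : Set X)) (hA : ∀ x ∈ V, A x ∈ V) (t : ℂ) {x : X} (hx : x ∈ V) :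
    NormedSpace.exp (t • A) x ∈ V := by
  have hpow : ∀ m : ℕ, (A ^ m) x ∈ V := by
    intro m
    induction m with
    | zero => simpa using hx
    | succ m ih =>
      rw [pow_succ']
      exact hA _ ih
  exact hV.mem_of_tendsto (hasSum_exp_smul_apply A t x)
    (Filter.Eventually.of_forall fun s => V.sum_mem fun m _ => V.smul_mem _ (hpow m))

/-- On `V` the functional turns `A ^ m` into `μ ^ m`; applied termwise, it turns the operator series
into the scalar one. -/
theorem apply_exp_smul_of_eigenfunctional [CompleteSpace X] (A : X →L[ℂ] X)
    {V : Submodule ℂ X}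
    (hA : ∀ x ∈ V, A x ∈ V) (Φ : X →L[ℂ] ℂ) {μ : ℂ} (hΦ : ∀ x ∈ V, Φ (A x) = μ * Φ x) (t : ℂ)
    {x : X} (hx : x ∈ V) :
    Φ (NormedSpace.exp (t • A) x) = Complex.exp (μ * t) * Φ x := by
  have hpow : ∀ m : ℕ, (A ^ m) x ∈ V ∧ Φ ((A ^ m) x) = μ ^ m * Φ x := by
    intro m
    induction m with
    | zero => simpa using hx
    | succ m ih =>
      rw [pow_succ']
      refine ⟨hA _ ih.1, ?_⟩
      rw [mul_apply_eq_comp, hΦ _ ih.1, ih.2, pow_succ', mul_assoc]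
  have h1 := (hasSum_exp_smul_apply A t x).mapL Φ
  have h2 := (NormedSpace.exp_series_hasSum_exp' (𝕂 := ℂ) (μ * t)).mul_right (Φ x)
  rw [← Complex.exp_eq_exp_ℂ] at h2
  refine h1.unique ?_
  have h3 : ∀ m : ℕ, Φ (((m.factorial : ℂ)⁻¹ * t ^ m) • (A ^ m) x)
      = ((m.factorial : ℂ)⁻¹ • (μ * t) ^ m) * Φ x := by
    intro m
    rw [map_smul, (hpow m).2]
    simp only [smul_eq_mul, mul_pow]
    ring
  simp only [h3]
  exact h2

theorem hasDerivAt_exp_ofReal_smul [CompleteSpace X] (A : X →L[ℂ] X) (t : ℝ) :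
    HasDerivAt (fun r : ℝ => NormedSpace.exp ((r : ℂ) • A))
      (NormedSpace.exp ((t : ℂ) • A) * A) t := by
  have h := (hasDerivAt_exp_smul_const (𝕂 := ℂ) A (t : ℂ)).scomp t Complex.ofRealCLM.hasDerivAt
  simpa [Function.comp_def] using h

/-- The operators are complex linear while time is real, so the product rule is applied after
restricting scalars. -/
theorem HasDerivAt.clm_apply_of_complex {c : ℝ → X →L[ℂ] X} {c' : X →L[ℂ] X} {v : ℝ → X} {v' : X}
    {t : ℝ} (hc : HasDerivAt c c' t) (hv : HasDerivAt v v' t) :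
    HasDerivAt (fun r => c r (v r)) (c' (v t) + c t v') t :=
  ((ContinuousLinearMap.restrictScalarsL ℂ X X ℝ ℝ).hasFDerivAt.comp_hasDerivAt t hc).clm_apply hv

theorem exp_smul_mul_exp_neg_smul [CompleteSpace X] (A : X →L[ℂ] X) (t : ℂ) :
    NormedSpace.exp (t • A) * NormedSpace.exp (-t • A) = 1 := by
  have hball : ∀ B : X →L[ℂ] X, B ∈ Metric.eball (0 : X →L[ℂ] X)
      (NormedSpace.expSeries ℂ (X →L[ℂ] X)).radius := fun B =>
    (NormedSpace.expSeries_radius_eq_top ℂ (X →L[ℂ] X)).symm ▸ edist_lt_top _ _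
  rw [← NormedSpace.exp_add_of_commute_of_mem_ball (𝕂 := ℂ)
    (((Commute.refl A).smul_left t).smul_right (-t)) (hball _) (hball _), ← add_smul, add_neg_cancel, zero_smul, NormedSpace.exp_zero]

theorem exp_zero_smul_apply (A : X →L[ℂ] X) (x : X) : NormedSpace.exp ((0 : ℂ) • A) x = x := by
  rw [zero_smul, NormedSpace.exp_zero, one_apply_eq_self]

theorem exp_smul_mul_comm (A : X →L[ℂ] X) (t : ℂ) :
    NormedSpace.exp (t • A) * A = A * NormedSpace.exp (t • A) :=
  (((Commute.refl A).smul_left t).exp_left).eq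

/-- The derivative of a curve does not depend on the presentation of the real structure. -/
theorem hasDerivAt_of_real_structure (i₁ i₂ : NormedSpace ℝ X)
    (h₁ : ∀ (r : ℝ) (x : X), (letI := i₁; r • x) = (r : ℂ) • x)
    (h₂ : ∀ (r : ℝ) (x : X), (letI := i₂; r • x) = (r : ℂ) • x) {f : ℝ → X} {f' : X} {t : ℝ}
    (h : letI := i₁; HasDerivAt f f' t) : letI := i₂; HasDerivAt f f' t := by
  have hi : i₁ = i₂ := by
    have hm : i₁.toModule = i₂.toModule :=
      Module.ext' _ _ fun r x => (h₁ r x).trans (h₂ r x).symm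
    cases i₁
    cases i₂
    congr
  subst hi
  exact h

/-- Solutions of the linear equation `v' = A v` for `t > 0` that are continuous at `0`. -/
theorem eq_exp_smul_apply_of_hasDerivAt [CompleteSpace X] (A : X →L[ℂ] X) {v : ℝ → X}
    (hc : ContinuousWithinAt v (Set.Ioi 0) 0)
    (hv : ∀ t, 0 < t → HasDerivAt v (A (v t)) t) {t : ℝ} (ht : 0 < t) :
    v t = NormedSpace.exp ((t : ℂ) • A) (v 0) := by
  -- The integrating factor `exp(-rA)` makes the curve constant on `r > 0`.
  set w : ℝ → X := fun r => NormedSpace.exp (((-r : ℝ) : ℂ) • A) (v r) with hw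
  have hE : ∀ r : ℝ, HasDerivAt (fun r : ℝ => NormedSpace.exp (((-r : ℝ) : ℂ) • A))
      (-(NormedSpace.exp (((-r : ℝ) : ℂ) • A) * A)) r := by
    intro r
    have := (hasDerivAt_exp_ofReal_smul A (-r)).scomp r (hasDerivAt_neg r)
    simpa [Function.comp_def] using this
  have hd : ∀ r, 0 < r → HasDerivAt w 0 r := by
    intro r hr
    have := (hE r).clm_apply_of_complex (hv r hr)
    simpa only [neg_apply, mul_apply_eq_comp, neg_add_cancel] using this
  have hconst : ∀ r, 0 < r → w r = w t := by
    intro r hr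
    exact isOpen_Ioi.is_const_of_deriv_eq_zero isPreconnected_Ioi
      (fun r hr => (hd r hr).differentiableAt.differentiableWithinAt)
      (fun r hr => (hd r hr).deriv) hr ht
  -- The equation says nothing at `0`; right continuity there identifies the constant with the
  -- initial value.
  have hw0 : Filter.Tendsto w (nhdsWithin 0 (Set.Ioi 0)) (nhds (w 0)) :=
    (hE 0).continuousAt.continuousWithinAt.clm_apply hc
  have hlim : w 0 = w t := by
    refine tendsto_nhds_unique hw0 (tendsto_const_nhds.congr' ?_)
    filter_upwards [self_mem_nhdsWithin] with r hr
    exact (hconst r hr).symm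
  have h0 : w 0 = v 0 := by simp [hw]
  rw [← h0, hlim, hw]
  have := congrArg (fun B : X →L[ℂ] X => B (v t)) (exp_smul_mul_exp_neg_smul A (t : ℂ))
  simpa using this.symm

end ExponentialOfOperator

end

/-! ### The Cauchy problem -/

theorem theorem2p0 (n : ℕ) (hn : 1 ≤ n) (J : Heisenberg n → ℝ) (hJ : Heisenberg.IsKernel J)
    (u₀ : Heisenberg n →₁[volume] ℂ) (hu₀ : Heisenberg.UnitaryInvariant u₀)
    (hu₀_hat : Integrable (fun p : ℝ × ℕ => Heisenberg.sphericalTransform u₀ p.1 p.2)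
      (Heisenberg.spectrumMeasure n)) :
    ∃ u : C(ℝ≥0, Heisenberg n →₁[volume] ℂ),
      Heisenberg.IsCauchySolution J u₀ u ∧
      (∀ v : C(ℝ≥0, Heisenberg n →₁[volume] ℂ), Heisenberg.IsCauchySolution J u₀ v → v = u) ∧
      (∀ t : ℝ≥0, Heisenberg.UnitaryInvariant (u t)) ∧
      ∀ (t : ℝ≥0) (l : ℝ) (k : ℕ), l ≠ 0 →
        Heisenberg.sphericalTransform (u t) l k =
          Complex.exp ((Heisenberg.sphericalTransform (fun x => (J x : ℂ)) l k - 1) * (t : ℂ)) *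
            Heisenberg.sphericalTransform u₀ l k := by
  set A : (Heisenberg n →₁[volume] ℂ) →L[ℂ] (Heisenberg n →₁[volume] ℂ) :=
    Heisenberg.convL J hJ.integrable - 1 with hA
  have hA_coe : ∀ v : Heisenberg n →₁[volume] ℂ,
      ∀ᵐ x, A v x = Heisenberg.conv J v x - v x := by
    intro v
    have hAv : A v = Heisenberg.convL J hJ.integrable v - v := rfl
    filter_upwards [Lp.coeFn_sub (Heisenberg.convL J hJ.integrable v) v,
      Heisenberg.coeFn_convL J hJ.integrable v] with x h1 h2
    rw [hAv, h1, Pi.sub_apply, h2]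
  have hA_inv : ∀ v ∈ Heisenberg.invariantSubmodule n, A v ∈ Heisenberg.invariantSubmodule n :=
    fun v hv => Submodule.sub_mem _
      (Heisenberg.convL_mem_invariantSubmodule hJ.integrable hJ.invariant hv) hv
  have hderiv : ∀ t : ℝ, HasDerivAt (fun r : ℝ => NormedSpace.exp ((r : ℂ) • A) u₀)
      (A (NormedSpace.exp ((t : ℂ) • A) u₀)) t := by
    intro t
    have := (hasDerivAt_exp_ofReal_smul A t).clm_apply_of_complex (hasDerivAt_const t u₀)
    rw [exp_smul_mul_comm, map_zero, add_zero] at this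
    -- The real structure of `L¹` in the equation is its own, whereas the derivative was computed in
    -- the one restricted from `ℂ`.
    exact hasDerivAt_of_real_structure NormedSpace.complexToReal inferInstance
      (fun _ _ => rfl) (fun r x => (algebraMap_smul ℂ r x).symm) this
  have hcont : Continuous fun r : ℝ => NormedSpace.exp ((r : ℂ) • A) u₀ :=
    continuous_iff_continuousAt.2 fun t => (hderiv t).continuousAt
  let u : C(ℝ≥0, Heisenberg n →₁[volume] ℂ) :=
    ⟨fun t => NormedSpace.exp (((t : ℝ) : ℂ) • A) u₀, hcont.comp NNReal.continuous_coe⟩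
  have hu0 : u 0 = u₀ := by
    change NormedSpace.exp ((((0 : ℝ≥0) : ℝ) : ℂ) • A) u₀ = u₀
    rw [NNReal.coe_zero, Complex.ofReal_zero]
    exact exp_zero_smul_apply A u₀
  have hu_inv : ∀ t : ℝ≥0, u t ∈ Heisenberg.invariantSubmodule n := fun t =>
    Submodule.exp_smul_apply_mem A Heisenberg.isClosed_invariantSubmodule hA_inv _ hu₀
  refine ⟨u, ⟨?_, fun t ht => ⟨A (u t), ?_, hA_coe (u t)⟩⟩, fun v hv => ?_, hu_inv,
    fun t l k hl => ?_⟩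
  · exact hu0
  · refine (hderiv t).congr_of_eventuallyEq ?_
    -- The curve `r ↦ u r.toNNReal` agrees with the exponential for `r ≥ 0`, hence near every `t >
    -- 0`.
    filter_upwards [lt_mem_nhds (NNReal.coe_pos.2 ht)] with r hr
    simp [u, Real.coe_toNNReal r hr.le]
  · have hvd : ∀ t : ℝ, 0 < t →
        letI : NormedSpace ℝ (Heisenberg n →₁[volume] ℂ) := NormedSpace.complexToReal
        HasDerivAt (fun r : ℝ => v r.toNNReal) (A (v t.toNNReal)) t := by
      intro t ht
      obtain ⟨w, hw, hwe⟩ := hv.equation t.toNNReal (Real.toNNReal_pos.2 ht)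
      have : w = A (v t.toNNReal) := by
        refine Lp.ext ?_
        filter_upwards [hwe, hA_coe (v t.toNNReal)] with x h1 h2
        rw [h1, h2]
      rw [Real.coe_toNNReal t ht.le, this] at hw
      exact hasDerivAt_of_real_structure inferInstance NormedSpace.complexToReal
        (fun r x => (algebraMap_smul ℂ r x).symm) (fun _ _ => rfl) hw
    have hvc : Continuous fun r : ℝ => v r.toNNReal := v.continuous.comp continuous_real_toNNReal
    ext1 t
    rcases eq_or_ne t 0 with rfl | ht
    · rw [hv.initial]
      exact hu0.symm
    · have := eq_exp_smul_apply_of_hasDerivAt A hvc.continuousWithinAt hvd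
        (NNReal.coe_pos.2 (pos_iff_ne_zero.2 ht))
      simpa [u, hv.initial] using this
  · obtain ⟨C, hC⟩ := Heisenberg.exists_norm_sphericalFunction_inv_le (n := n) hl k
    -- For `l ≠ 0` the spherical function is bounded, so the transform at `(l, k)` is a continuous
    -- functional on `L¹`; multiplicativity gives its eigenvalue under `A`.
    refine apply_exp_smul_of_eigenfunctional A hA_inv (Heisenberg.pairing _
      (Heisenberg.measurable_sphericalFunction_inv l k) C hC) (fun v hv => ?_) _ hu₀
    have h1 : Heisenberg.pairing _ (Heisenberg.measurable_sphericalFunction_inv l k) C hC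
        (Heisenberg.convL J hJ.integrable v) = Heisenberg.sphericalTransform
          (fun x => (J x : ℂ)) l k * Heisenberg.sphericalTransform v l k := by
      rw [← Heisenberg.sphericalTransform_conv hn hl k hJ.integrable hJ.invariant
        (L1.integrable_coeFn v) hv]
      refine integral_congr_ae ?_
      filter_upwards [Heisenberg.coeFn_convL J hJ.integrable v] with x hx
      rw [hx]
    rw [hA, sub_apply, map_sub, h1, sub_mul]
    simp [Heisenberg.pairing_apply, Heisenberg.sphericalTransform]
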